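/- \textbf{Setting.} Let $(\mathcal S,\mathcal A,\mathbb P,r,\gamma)$ be a discounted Markov decision process with finite $\mathcal S,\mathcal A$, rewards $r(s,a)\in[0,1]$ and $\gamma\in(0,1)$; let $\rho$ be an initial distribution on $\mathcal S$, and let $\pi_\theta(a|s)>0$, $\theta\in\mathbb R^d$, be a parameterized policy class such that $\log\pi_\theta(a|s)$ is twice differentiable in $\theta$ with $\|\nabla\log\pi_\theta(a|s)\|_2\le M_g$ and $\|\nabla^2\log\pi_\theta(a|s)\|_2\le M_h$ for all $\theta,s,a$, where $M_g,M_h>0$. (In particular $\pi_\theta$ may be any Fisher-non-degenerate class with these properties; non-degeneracy itself is not used.) For a horizon $H$, a truncated trajectory $\tau_H=(s_0,a_0,\dots,s_{H-1},a_{H-1},s_H)$ has probability $p(\tau_H|\theta,\rho)=\rho(s_0)\prod_{h=0}^{H-1}\pi_\theta(a_h|s_h)\mathbb P(s_{h+1}|s_h,a_h)$. Put $$J_\rho^H(\theta)=\mathbb E_{\tau_H\sim p(\cdot|\theta,\rho)}\Big[\sum_{h=0}^{H-1}\gamma^h r(s_h,a_h)\Big],\qquad g(\tau_H|\theta)=\sum_{h=0}^{H-1}\sum_{j=0}^{h}\nabla\log\pi_\theta(a_j|s_j)\,\big(\gamma^h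 r(s_h,a_h)-b_h\big),$$ where the constant baselines $b_h$ satisfy $|\gamma^h r(s,a)-b_h|\le\gamma^h$ for all $s,a$ (e.g. $b_h=0$), and $w(\tau_H|\theta',\theta)=\prod_{h=0}^{H-1}\pi_{\theta'}(a_h|s_h)/\pi_\theta(a_h|s_h)$. \textbf{Algorithm (STORM-PG-F).} Given $\theta_1\in\mathbb R^d$, a batch size $B\ge1$ and parameters $k,m,c$, at iteration $t=1,2,\dots$ draw, given the past, $B$ independent trajectories $\tau^1,\dots,\tau^B\sim p(\cdot|\theta_t,\rho)$; set $u_1=\frac1B\sum_i g(\tau^i|\theta_1)$ and, for $t\ge2$, $$u_t=\frac{\beta_t}{B}\sum_{i=1}^B g(\tau^i|\theta_t)+(1-\beta_t)\Big[u_{t-1}+\frac1B\sum_{i=1}^B\big(g(\tau^i|\theta_t)-w(\tau^i|\theta_{t-1},\theta_t)\,g(\tau^i|\theta_{t-1})\big)\Big];$$ then $\theta_{t+1}=\theta_t+\eta_tu_t$, with $\eta_t=\frac{k}{(m+t)^{1/3}}$ and $\beta_{t+1}=c\,\eta_t^2$. \textbf{Statement.} Let $W>0$, $k>0$, and put $$L_g=\tfrac{M_h}{(1-\gamma)^2},\quad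 G=\sigma=\tfrac{M_g}{(1-\gamma)^2},\quad L=\tfrac{2M_g^2}{(1-\gamma)^3}+\tfrac{M_h}{(1-\gamma)^2},\quad C_w=\sqrt{H(2HM_g^2+M_h)(W+1)},\quad b^2=L_g^2+G^2C_w^2,$$ $$c=\tfrac{1}{3k^3L}+96b^2,\qquad m=\max\big\{2,(2Lk)^3,(\tfrac{ck}{2L})^3\big\}.$$ Let $T\ge1$ and suppose that, almost surely for the iterates of the algorithm run with these $k,m,c$, the variance of $w(\tau_H|\theta_t,\theta_{t+1})$ for $\tau_H\sim p(\cdot|\theta_{t+1},\rho)$ is at most $W$ for all $1\le t<T$. Then $$\frac1T\sum_{t=1}^T\mathbb E\|\nabla J_\rho^H(\theta_t)\|_2\le\sqrt{\frac{\Gamma_2}{k}+\frac{\Gamma_1+\Gamma_3}{kB}}\left(\frac{m^{1/6}}{\sqrt T}+\frac1{T^{1/3}}\right),$$ where $$\Gamma_1=\frac{c^2\sigma^2k^3\ln(T+2)}{48b^2}+\frac{m^{1/3}\sigma^2}{96b^2k}+\frac1{22(1-\gamma)},\qquad \Gamma_2=\frac{48}{11(1-\gamma)},\qquad \Gamma_3=\frac{\sigma^2m^{1/3}}{44b^2k^2}+\frac{c^2\sigma^2k^3}{22kb^2}\ln(2+T).$$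 Consequently there is a constant $C$ depending only on $\gamma,M_g,M_h,W,k,H$ (not on $T$, the batch size $B\ge1$, or the rest of the data) such that $\frac1T\sum_{t=1}^T\mathbb E\|\nabla J_\rho^H(\theta_t)\|_2\le C\sqrt{\ln(T+2)}\;T^{-1/3}$, i.e. the rate $\widetilde O(T^{-1/3})$ with a constant batch size. -/

import Mathlib

open scoped BigOperators

noncomputable section

namespace StormPG

/-- The parameter space `ℝ^d` with its Euclidean norm. -/
abbrev Param (d : ℕ) : Type := EuclideanSpace ℝ (Fin d)

/-- A discounted Markov decision process `(S, A, P, r, γ)`, with `S` finite, rewards in `[0, 1]`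
and discount factor in `(0, 1)`. -/
structure MDP (S A : Type*) [Fintype S] where
  /-- `P s a s'` is the probability of moving from `s` to `s'` under the action `a`. -/
  P : S → A → S → ℝ
  /-- The reward function. -/
  r : S → A → ℝ
  /-- The discount factor. -/
  γ : ℝ
  P_mem : ∀ s a, P s a ∈ stdSimplex ℝ S
  r_mem : ∀ s a, r s a ∈ Set.Icc (0 : ℝ) 1
  γ_mem : γ ∈ Set.Ioo (0 : ℝ) 1

/-- A parameterized family of stochastic policies `π_θ(a|s)`, `θ ∈ ℝ^d`, with positive
probabilities (so that `log π_θ(a|s)` makes sense). -/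
structure PolicyClass (S A : Type*) [Fintype A] (d : ℕ) where
  /-- `prob θ s a` is `π_θ(a|s)`. -/
  prob : Param d → S → A → ℝ
  prob_pos : ∀ θ s a, 0 < prob θ s a
  sum_prob : ∀ θ s, ∑ a, prob θ s a = 1

/-- The score function `∇_θ log π_θ(a|s)`. -/
def PolicyClass.score {S A : Type*} [Fintype A] {d : ℕ} (π : PolicyClass S A d)
    (θ : Param d) (s : S) (a : A) : Param d :=
  gradient (fun θ' => Real.log (π.prob θ' s a)) θ

/-- `log π_θ(a|s)` is twice differentiable in `θ`, with `‖∇ log π_θ(a|s)‖₂ ≤ M_g` and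
`‖∇² log π_θ(a|s)‖₂ ≤ M_h` (operator norm of the derivative of the gradient). -/
structure PolicyClass.ScoreBounded {S A : Type*} [Fintype A] {d : ℕ} (π : PolicyClass S A d)
    (Mg Mh : ℝ) : Prop where
  differentiable_log : ∀ s a, Differentiable ℝ (fun θ => Real.log (π.prob θ s a))
  differentiable_score : ∀ s a, Differentiable ℝ (fun θ => π.score θ s a)
  norm_score_le : ∀ θ s a, ‖π.score θ s a‖ ≤ Mg
  norm_hessian_le : ∀ θ s a, ‖fderiv ℝ (fun θ' => π.score θ' s a) θ‖ ≤ Mh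

/-- Truncated trajectories `τ_H = (s_0, a_0, s_1, …, s_{H-1}, a_{H-1}, s_H)`: the states
`s_0, …, s_H` and the actions `a_0, …, a_{H-1}`. -/
abbrev Traj (S A : Type*) (H : ℕ) : Type _ := (Fin (H + 1) → S) × (Fin H → A)

/-- The state `s_h`, for `h < H`. -/
abbrev Traj.state {S A : Type*} {H : ℕ} (τ : Traj S A H) (h : Fin H) : S := τ.1 h.castSucc

/-- The state `s_{h+1}`, for `h < H`. -/
abbrev Traj.nextState {S A : Type*} {H : ℕ} (τ : Traj S A H) (h : Fin H) : S := τ.1 h.succ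

/-- The action `a_h`, for `h < H`. -/
abbrev Traj.action {S A : Type*} {H : ℕ} (τ : Traj S A H) (h : Fin H) : A := τ.2 h

section Model

variable {S A : Type*} [Fintype S] [Fintype A] {d : ℕ}

/-- The probability `p(τ_H | θ, ρ)` of a truncated trajectory. -/
def trajProb (M : MDP S A) (ρ : S → ℝ) (π : PolicyClass S A d) {H : ℕ}
    (θ : Param d) (τ : Traj S A H) : ℝ :=
  ρ (τ.1 0) * ∏ h : Fin H,
    (π.prob θ (Traj.state τ h) (Traj.action τ h) *
      M.P (Traj.state τ h) (Traj.action τ h) (Traj.nextState τ h))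

/-- The expectation of `f(τ_H)` for `τ_H ∼ p(· | θ, ρ)`. -/
def trajMean (M : MDP S A) (ρ : S → ℝ) (π : PolicyClass S A d) {H : ℕ}
    (θ : Param d) (f : Traj S A H → ℝ) : ℝ :=
  ∑ τ : Traj S A H, trajProb M ρ π θ τ * f τ

/-- The variance of `f(τ_H)` for `τ_H ∼ p(· | θ, ρ)`. -/
def trajVar (M : MDP S A) (ρ : S → ℝ) (π : PolicyClass S A d) {H : ℕ}
    (θ : Param d) (f : Traj S A H → ℝ) : ℝ :=
  trajMean M ρ π θ (fun τ => (f τ - trajMean M ρ π θ f) ^ 2)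

/-- The truncated value function `J_ρ^H(θ) = E[∑_{h<H} γ^h r(s_h, a_h)]`. -/
def truncValue (M : MDP S A) (ρ : S → ℝ) (π : PolicyClass S A d) (H : ℕ) (θ : Param d) : ℝ :=
  trajMean M ρ π θ (fun τ : Traj S A H =>
    ∑ h : Fin H, M.γ ^ (h : ℕ) * M.r (Traj.state τ h) (Traj.action τ h))

/-- The truncated GPOMDP estimator with baselines `b_0, …, b_{H-1}`:
`g(τ_H | θ) = ∑_{h<H} ∑_{j≤h} ∇ log π_θ(a_j|s_j) (γ^h r(s_h, a_h) - b_h)`. -/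
def gpomdp (M : MDP S A) (π : PolicyClass S A d) {H : ℕ} (b : Fin H → ℝ)
    (θ : Param d) (τ : Traj S A H) : Param d :=
  ∑ h : Fin H, ∑ j ∈ Finset.Iic h,
    (M.γ ^ (h : ℕ) * M.r (Traj.state τ h) (Traj.action τ h) - b h) •
      π.score θ (Traj.state τ j) (Traj.action τ j)

/-- The importance sampling weight `w(τ_H | θ', θ) = ∏_{h<H} π_{θ'}(a_h|s_h) / π_θ(a_h|s_h)`. -/
def isWeight (π : PolicyClass S A d) {H : ℕ} (θ' θ : Param d) (τ : Traj S A H) : ℝ :=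
  ∏ h : Fin H, π.prob θ' (Traj.state τ h) (Traj.action τ h) /
    π.prob θ (Traj.state τ h) (Traj.action τ h)

/-- The step sizes `η_t = k / (m + t)^{1/3}`. -/
def stepSize (k m : ℝ) (t : ℕ) : ℝ := k / (m + t) ^ (1 / 3 : ℝ)

/-- The momentum parameters, `β_{t+1} = c η_t²`, that is, `β_t = c η_{t-1}²` for `t ≥ 2`. -/
def momentum (k m c : ℝ) (t : ℕ) : ℝ := c * stepSize k m (t - 1) ^ 2

/-- What the algorithm keeps in memory when iteration `t` starts: the current iterate `θ_t`, the
previous iterate `θ_{t-1}` and the previous direction `u_{t-1}`. (The last two are not used when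
`t = 1`.) -/
structure State (d : ℕ) where
  /-- The current iterate `θ_t`. -/
  cur : Param d
  /-- The previous iterate `θ_{t-1}`. -/
  prev : Param d
  /-- The previous direction `u_{t-1}`. -/
  dir : Param d

/-- The direction `u_t` computed at iteration `t` from the batch `D` of `B` trajectories: for
`t = 1` the average of the estimators, for `t ≥ 2` the momentum-based policy gradient. -/
def direction (M : MDP S A) (π : PolicyClass S A d) {H : ℕ} (b : Fin H → ℝ) (k m c : ℝ) {B : ℕ}
    (t : ℕ) (x : State d) (D : Fin B → Traj S A H) : Param d :=
  if t = 1 then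
    (1 / (B : ℝ)) • ∑ i, gpomdp M π b x.cur (D i)
  else
    (momentum k m c t / (B : ℝ)) • ∑ i, gpomdp M π b x.cur (D i) +
      (1 - momentum k m c t) • (x.dir + (1 / (B : ℝ)) • ∑ i,
        (gpomdp M π b x.cur (D i) -
          isWeight π x.prev x.cur (D i) • gpomdp M π b x.prev (D i)))

/-- Iteration `t`: compute `u_t` and update `θ_{t+1} = θ_t + η_t u_t`. -/
def step (M : MDP S A) (π : PolicyClass S A d) {H : ℕ} (b : Fin H → ℝ) (k m c : ℝ) {B : ℕ}
    (t : ℕ) (x : State d) (D : Fin B → Traj S A H) : State d where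
  cur := x.cur + stepSize k m t • direction M π b k m c t x D
  prev := x.cur
  dir := direction M π b k m c t x D

/-- The memory of the algorithm after `n` iterations, as a function of the batches drawn in the
iterations `1, …, n`; its field `cur` is `θ_{n+1}`. The initial input is `θ₁`. -/
def run (M : MDP S A) (π : PolicyClass S A d) {H : ℕ} (b : Fin H → ℝ) (k m c : ℝ) {B : ℕ}
    (θ₁ : Param d) : (n : ℕ) → (Fin n → Fin B → Traj S A H) → State d
  | 0, _ => ⟨θ₁, θ₁, 0⟩
  | n + 1, ω => step M π b k m c (n + 1) (run M π b k m c θ₁ n (Fin.init ω)) (ω (Fin.last n))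

/-- The probability that the batches drawn in the iterations `1, …, n` are `ω`: given the past, the
`B` trajectories of iteration `t` are drawn independently from `p(· | θ_t, ρ)`. -/
def runProb (M : MDP S A) (ρ : S → ℝ) (π : PolicyClass S A d) {H : ℕ} (b : Fin H → ℝ)
    (k m c : ℝ) {B : ℕ} (θ₁ : Param d) : (n : ℕ) → (Fin n → Fin B → Traj S A H) → ℝ
  | 0, _ => 1
  | n + 1, ω => runProb M ρ π b k m c θ₁ n (Fin.init ω) *
      ∏ i, trajProb M ρ π (run M π b k m c θ₁ n (Fin.init ω)).cur (ω (Fin.last n) i)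

/-- `E ‖∇ J_ρ^H(θ_{n+1})‖₂` for the algorithm with batch size `B` and initial input `θ₁`. -/
def meanGradNorm (M : MDP S A) (ρ : S → ℝ) (π : PolicyClass S A d) {H : ℕ} (b : Fin H → ℝ)
    (k m c : ℝ) (B : ℕ) (θ₁ : Param d) (n : ℕ) : ℝ :=
  ∑ ω : Fin n → Fin B → Traj S A H, runProb M ρ π b k m c θ₁ n ω *
    ‖gradient (truncValue M ρ π H) (run M π b k m c θ₁ n ω).cur‖

/-- Along the first `T` iterates of the algorithm, almost surely,
`Var(w(τ_H | θ_t, θ_{t+1})) ≤ W` for `τ_H ∼ p(· | θ_{t+1}, ρ)`, `t = 1, …, T - 1`. -/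
def WeightVarianceBounded (M : MDP S A) (ρ : S → ℝ) (π : PolicyClass S A d) {H : ℕ}
    (b : Fin H → ℝ) (k m c : ℝ) (B : ℕ) (θ₁ : Param d) (T : ℕ) (W : ℝ) : Prop :=
  ∀ t : ℕ, 1 ≤ t → t < T → ∀ ω : Fin t → Fin B → Traj S A H, 0 < runProb M ρ π b k m c θ₁ t ω →
    trajVar M ρ π (run M π b k m c θ₁ t ω).cur
      (isWeight (H := H) π (run M π b k m c θ₁ t ω).prev (run M π b k m c θ₁ t ω).cur) ≤ W

end Model

/-- The constants from which the parameters of the algorithm and the bound are computed. -/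
structure Consts where
  /-- The discount factor. -/
  γ : ℝ
  /-- The bound on the gradient of `log π_θ(a|s)`. -/
  Mg : ℝ
  /-- The bound on the Hessian of `log π_θ(a|s)`. -/
  Mh : ℝ
  /-- The bound on the variance of the importance sampling weights. -/
  W : ℝ
  /-- The step size parameter. -/
  k : ℝ
  /-- The horizon. -/
  H : ℕ

namespace Consts

variable (K : Consts)

/-- `L_g = M_h / (1-γ)²`. -/
def Lg : ℝ := K.Mh / (1 - K.γ) ^ 2

/-- `G = M_g / (1-γ)²`. -/
def G : ℝ := K.Mg / (1 - K.γ) ^ 2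

/-- `σ = G`. -/
def σ : ℝ := K.G

/-- `L = 2 M_g² / (1-γ)³ + M_h / (1-γ)²`. -/
def L : ℝ := 2 * K.Mg ^ 2 / (1 - K.γ) ^ 3 + K.Mh / (1 - K.γ) ^ 2

/-- `C_w = √(H (2 H M_g² + M_h) (W + 1))`. -/
def Cw : ℝ := Real.sqrt (K.H * (2 * K.H * K.Mg ^ 2 + K.Mh) * (K.W + 1))

/-- `b² = L_g² + G² C_w²`. -/
def bSq : ℝ := K.Lg ^ 2 + K.G ^ 2 * K.Cw ^ 2

/-- `c = 1 / (3 k³ L) + 96 b²`. -/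
def c : ℝ := 1 / (3 * K.k ^ 3 * K.L) + 96 * K.bSq

/-- `m = max {2, (2 L k)³, (c k / (2 L))³}`. -/
def m : ℝ := max 2 (max ((2 * K.L * K.k) ^ 3) ((K.c * K.k / (2 * K.L)) ^ 3))

/-- `Γ₁ = c² σ² k³ ln(T+2) / (48 b²) + m^{1/3} σ² / (96 b² k) + 1 / (22 (1-γ))`. -/
def Γ₁ (T : ℕ) : ℝ :=
  K.c ^ 2 * K.σ ^ 2 * K.k ^ 3 * Real.log (T + 2) / (48 * K.bSq) +
    K.m ^ (1 / 3 : ℝ) / (96 * K.bSq * K.k) * K.σ ^ 2 + 1 / (22 * (1 - K.γ))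

/-- `Γ₂ = 48 / (11 (1-γ))`. -/
def Γ₂ : ℝ := 48 / (11 * (1 - K.γ))

/-- `Γ₃ = σ² m^{1/3} / (44 b² k²) + c² σ² k³ ln(2+T) / (22 k b²)`. -/
def Γ₃ (T : ℕ) : ℝ :=
  K.σ ^ 2 * K.m ^ (1 / 3 : ℝ) / (44 * K.bSq * K.k ^ 2) +
    K.c ^ 2 * K.σ ^ 2 * K.k ^ 3 / (22 * K.k * K.bSq) * Real.log (2 + T)

end Consts

end StormPG

end

set_option linter.unusedSectionVars false

namespace StormPG

/-! ### Calculus on the line and power sums -/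

/-! Three facts about the model drive the proof. First, `truncValue` is `L`-smooth
(`le_truncValue_add`) and takes values in `[0, 1/(1-γ)]`. Second, the estimator is unbiased
(`hasGradientAt_truncValue`), bounded by `G` and `L_g`-Lipschitz in the parameter. Third, the
variance of an importance weight is at most `C_w² ‖θ' - θ‖²` as soon as it is at most `W`
(`trajVar_isWeight_le`). All three come from differentiating exponentials of the log-likelihood
along the segment between two parameters.

Given the past, the momentum direction is a fixed vector plus a batch average of independent terms.
Its mean square error `V` therefore contracts by `(1-β)²` at each iteration, up to a noise of order
`(β² G² + b² η² E‖u‖²)/B` (`mean_norm_direction_sub_sq_le`). In the other direction, smoothness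
makes one step increase the mean of `J` by at least `η/2 E‖∇J‖² + η/4 E‖u‖² - η/2 V`
(`runMean_truncValue_ge`).

The two inequalities are coupled by the potential `192 b² E J - V/η` (`sum_mul_le_of_descent`). The
constant `c` is such that the contraction of `V/η` pays both for the growth of `1/η` and for the
loss `η/2 V` in the descent, while the gain `η/4 E‖u‖²` absorbs the noise proportional to `E‖u‖²`.
What is left is `∑ η³`, which is logarithmic. This bounds `∑ η_t E‖∇J(θ_t)‖²`; monotonicity of `η`,
Jensen and Cauchy–Schwarz turn it into the bound on the average norm
(`average_le_of_sum_stepSize_mul_le`). -/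

theorem le_taylor_of_second_deriv_le {f f' f'' : ℝ → ℝ} {K : ℝ}
    (hf : ∀ s, HasDerivAt f (f' s) s) (hf' : ∀ s, HasDerivAt f' (f'' s) s)
    (hK : ∀ s ∈ Set.Icc (0 : ℝ) 1, f'' s ≤ K) {s : ℝ} (hs : s ∈ Set.Icc (0 : ℝ) 1) :
    f s ≤ f 0 + f' 0 * s + K / 2 * s ^ 2 := by
  have h0 : (0 : ℝ) ∈ Set.Icc (0 : ℝ) 1 := ⟨le_rfl, zero_le_one⟩
  -- The mean value inequality is used twice, for `f'` and then for `f` minus its quadratic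
  -- majorant, so that `f''` need not be continuous; the scores are only assumed differentiable.
  have h1 : ∀ x ∈ Set.Icc (0 : ℝ) 1, f' x ≤ f' 0 + K * x := by
    intro x hx
    have := (convex_Icc (0 : ℝ) 1).image_sub_le_mul_sub_of_deriv_le (f := f') (C := K)
      (fun y _ => (hf' y).continuousAt.continuousWithinAt)
      (fun y _ => (hf' y).differentiableAt.differentiableWithinAt)
      (fun y hy => by rw [(hf' y).deriv]; exact hK y (interior_subset hy)) 0 h0 x hx hx.1
    linarith
  have hg : ∀ x, HasDerivAt (fun x => f x - f' 0 * x - K / 2 * x ^ 2)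
      (f' x - f' 0 - K * x) x := by
    intro x
    refine (((hf x).sub ((hasDerivAt_id x).const_mul (f' 0))).sub
      (((hasDerivAt_id x).pow 2).const_mul (K / 2))).congr_deriv ?_
    simp
    ring
  have := (convex_Icc (0 : ℝ) 1).image_sub_le_mul_sub_of_deriv_le (C := 0)
      (fun y _ => (hg y).continuousAt.continuousWithinAt)
      (fun y _ => (hg y).differentiableAt.differentiableWithinAt)
      (fun y hy => by rw [(hg y).deriv]; linarith [h1 y (interior_subset hy)]) 0 h0 s hs hs.1
  simp at this
  linarith

/-- With `φ` a log-likelihood along a line, `α = 1` serves means over trajectories and `α = 2`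
second moments of importance weights. -/
theorem hasDerivAt_sum_exp {ι : Type*} [Fintype ι] (w : ι → ℝ) (α : ℝ) {φ φ' : ι → ℝ → ℝ}
    (hφ : ∀ i s, HasDerivAt (φ i) (φ' i s) s) (s : ℝ) :
    HasDerivAt (fun s => ∑ i, w i * Real.exp (α * φ i s))
      (∑ i, w i * (α * φ' i s * Real.exp (α * φ i s))) s := by
  refine HasDerivAt.fun_sum fun i _ => ?_
  refine ((((hφ i s).const_mul α).exp).const_mul (w i)).congr_deriv ?_
  ring

theorem hasDerivAt_sum_exp' {ι : Type*} [Fintype ι] (w : ι → ℝ) (α : ℝ)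
    {φ φ' φ'' : ι → ℝ → ℝ} (hφ : ∀ i s, HasDerivAt (φ i) (φ' i s) s)
    (hφ' : ∀ i s, HasDerivAt (φ' i) (φ'' i s) s) (s : ℝ) :
    HasDerivAt (fun s => ∑ i, w i * (α * φ' i s * Real.exp (α * φ i s)))
      (∑ i, w i * ((α * φ'' i s + (α * φ' i s) ^ 2) * Real.exp (α * φ i s))) s := by
  refine HasDerivAt.fun_sum fun i _ => ?_
  refine ((((hφ' i s).const_mul α).mul ((hφ i s).const_mul α).exp).const_mul (w i)).congr_deriv ?_
  ring

theorem sum_pow_le {γ : ℝ} (hγ : γ ∈ Set.Ioo (0 : ℝ) 1) (H : ℕ) :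
    ∑ h ∈ Finset.range H, γ ^ h ≤ 1 / (1 - γ) := by
  have h1 : 0 < 1 - γ := by linarith [hγ.2]
  rw [le_div_iff₀ h1]
  have := geom_sum_mul γ H
  have h2 := pow_nonneg hγ.1.le H
  linarith

theorem sum_mul_pow_le {γ : ℝ} (hγ : γ ∈ Set.Ioo (0 : ℝ) 1) (H : ℕ) :
    ∑ h ∈ Finset.range H, ((h : ℝ) + 1) * γ ^ h ≤ 1 / (1 - γ) ^ 2 := by
  have h1 : 0 < 1 - γ := by linarith [hγ.2]
  have key : ∀ H : ℕ, (∑ h ∈ Finset.range H, ((h : ℝ) + 1) * γ ^ h) * (1 - γ) + H * γ ^ H =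
      ∑ h ∈ Finset.range H, γ ^ h := by
    intro H
    induction H with
    | zero => simp
    | succ n ih =>
      rw [Finset.sum_range_succ, Finset.sum_range_succ, ← ih]
      push_cast
      ring
  have h2 : 0 ≤ H * γ ^ H := mul_nonneg (Nat.cast_nonneg H) (pow_nonneg hγ.1.le H)
  have h3 := sum_pow_le hγ H
  rw [pow_two, ← div_div, le_div_iff₀ h1]
  linarith [key H]

theorem sum_sq_mul_pow_le {γ : ℝ} (hγ : γ ∈ Set.Ioo (0 : ℝ) 1) (H : ℕ) :
    ∑ h ∈ Finset.range H, ((h : ℝ) + 1) ^ 2 * γ ^ h ≤ 2 / (1 - γ) ^ 3 := by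
  have h1 : 0 < 1 - γ := by linarith [hγ.2]
  -- The weight `(h+1)²` is enlarged to `(h+1)(h+2)`, for which multiplication by `1 - γ` lowers the
  -- degree exactly.
  have key : ∀ H : ℕ, (∑ h ∈ Finset.range H, ((h : ℝ) + 1) * (h + 2) * γ ^ h) * (1 - γ) +
      H * (H + 1) * γ ^ H = 2 * ∑ h ∈ Finset.range H, ((h : ℝ) + 1) * γ ^ h := by
    intro H
    induction H with
    | zero => simp
    | succ n ih =>
      rw [Finset.sum_range_succ, Finset.sum_range_succ, mul_add (2 : ℝ), ← ih]
      push_cast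
      ring
  have h2 : 0 ≤ H * (H + 1) * γ ^ H := by have := pow_nonneg hγ.1.le H; positivity
  have h3 := sum_mul_pow_le hγ H
  have h4 : ∑ h ∈ Finset.range H, ((h : ℝ) + 1) ^ 2 * γ ^ h ≤
      ∑ h ∈ Finset.range H, ((h : ℝ) + 1) * (h + 2) * γ ^ h := by
    refine Finset.sum_le_sum fun h _ => ?_
    have := pow_nonneg hγ.1.le h
    gcongr
    nlinarith [Nat.cast_nonneg (α := ℝ) h]
  refine h4.trans ?_
  have h5 : (2 : ℝ) / (1 - γ) ^ 3 = 2 * (1 / (1 - γ) ^ 2) / (1 - γ) := by field_simp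
  rw [h5, le_div_iff₀ h1]
  linarith [key H]

/-! ### The likelihood of a trajectory -/

section Likelihood

variable {S A : Type*} [Fintype S] [Fintype A] {d : ℕ}

/-- The part `∑_h log π_θ(a_h|s_h)` of the log-likelihood that depends on `θ`. -/
noncomputable def logLik (π : PolicyClass S A d) {H : ℕ} (θ : Param d) (τ : Traj S A H) : ℝ :=
  ∑ h, Real.log (π.prob θ (Traj.state τ h) (Traj.action τ h))

/-- The part `ρ(s_0) ∏_h P(s_{h+1}|s_h, a_h)` of the likelihood that does not depend on `θ`. -/
noncomputable def envWeight (M : MDP S A) (ρ : S → ℝ) {H : ℕ} (τ : Traj S A H) : ℝ :=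
  ρ (τ.1 0) * ∏ h : Fin H, M.P (Traj.state τ h) (Traj.action τ h) (Traj.nextState τ h)

/-- The score `∑_h ∇ log π_θ(a_h|s_h)` of a trajectory. -/
noncomputable def scoreSum (π : PolicyClass S A d) {H : ℕ} (θ : Param d) (τ : Traj S A H) :
    Param d :=
  ∑ h, π.score θ (Traj.state τ h) (Traj.action τ h)

/-- The second derivative of the log-likelihood in the direction `v`. -/
noncomputable def logLikHess (π : PolicyClass S A d) {H : ℕ} (θ v : Param d) (τ : Traj S A H) :
    ℝ :=
  ∑ h, inner ℝ (fderiv ℝ (fun θ' => π.score θ' (Traj.state τ h) (Traj.action τ h)) θ v) v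

variable (M : MDP S A) (ρ : S → ℝ) (π : PolicyClass S A d) {H : ℕ}

theorem exp_logLik (θ : Param d) (τ : Traj S A H) :
    Real.exp (logLik π θ τ) = ∏ h, π.prob θ (Traj.state τ h) (Traj.action τ h) := by
  rw [logLik, Real.exp_sum]
  exact Finset.prod_congr rfl fun h _ => Real.exp_log (π.prob_pos _ _ _)

theorem trajProb_eq (θ : Param d) (τ : Traj S A H) :
    trajProb M ρ π θ τ = envWeight M ρ τ * Real.exp (logLik π θ τ) := by
  rw [exp_logLik, trajProb, envWeight, Finset.prod_mul_distrib]
  ring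

theorem isWeight_eq (θ' θ : Param d) (τ : Traj S A H) :
    isWeight π θ' θ τ = Real.exp (logLik π θ' τ - logLik π θ τ) := by
  rw [Real.exp_sub, exp_logLik, exp_logLik, isWeight, Finset.prod_div_distrib]

theorem trajProb_mul_isWeight (θ' θ : Param d) (τ : Traj S A H) :
    trajProb M ρ π θ τ * isWeight π θ' θ τ = trajProb M ρ π θ' τ := by
  rw [isWeight_eq, trajProb_eq, trajProb_eq, mul_assoc, ← Real.exp_add]
  congr 2
  ring

variable {M ρ π}

theorem envWeight_nonneg (hρ : ρ ∈ stdSimplex ℝ S) (τ : Traj S A H) : 0 ≤ envWeight M ρ τ :=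
  mul_nonneg (hρ.1 _) (Finset.prod_nonneg fun _ _ => (M.P_mem _ _).1 _)

theorem trajProb_nonneg (hρ : ρ ∈ stdSimplex ℝ S) (θ : Param d) (τ : Traj S A H) :
    0 ≤ trajProb M ρ π θ τ := by
  rw [trajProb_eq]
  exact mul_nonneg (envWeight_nonneg hρ τ) (Real.exp_pos _).le

variable {Mg Mh : ℝ}

theorem hasGradientAt_logLik (hπ : π.ScoreBounded Mg Mh) (θ : Param d) (τ : Traj S A H) :
    HasGradientAt (fun θ => logLik π θ τ) (scoreSum π θ τ) θ := by
  rw [hasGradientAt_iff_hasFDerivAt, scoreSum, map_sum]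
  exact HasFDerivAt.fun_sum fun h _ =>
    ((hπ.differentiable_log _ _).differentiableAt (x := θ)).hasGradientAt.hasFDerivAt

theorem hasDerivAt_line (θ v : Param d) (s : ℝ) :
    HasDerivAt (fun s : ℝ => θ + s • v) v s := by
  simpa using ((hasDerivAt_id s).smul_const v).const_add θ

theorem hasDerivAt_logLik_line (hπ : π.ScoreBounded Mg Mh) (θ v : Param d) (τ : Traj S A H)
    (s : ℝ) :
    HasDerivAt (fun s : ℝ => logLik π (θ + s • v) τ) (inner ℝ (scoreSum π (θ + s • v) τ) v) s := by
  have := (hasGradientAt_logLik hπ (θ + s • v) τ).hasFDerivAt.comp_hasDerivAt s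
    (hasDerivAt_line θ v s)
  exact this.congr_deriv (by simp)

theorem hasDerivAt_scoreSum_line (hπ : π.ScoreBounded Mg Mh) (θ v : Param d) (τ : Traj S A H)
    (s : ℝ) :
    HasDerivAt (fun s : ℝ => inner ℝ (scoreSum π (θ + s • v) τ) v)
      (logLikHess π (θ + s • v) v τ) s := by
  simp only [scoreSum, sum_inner, logLikHess]
  refine HasDerivAt.fun_sum fun h _ => ?_
  have h1 := ((hπ.differentiable_score (Traj.state τ h) (Traj.action τ h)).differentiableAt
    (x := θ + s • v)).hasFDerivAt.comp_hasDerivAt s (hasDerivAt_line θ v s)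
  simpa using h1.inner ℝ (hasDerivAt_const s v)

theorem norm_scoreSum_le (hπ : π.ScoreBounded Mg Mh) (θ : Param d) (τ : Traj S A H) :
    ‖scoreSum π θ τ‖ ≤ H * Mg := by
  refine (norm_sum_le_of_le _ fun h _ => hπ.norm_score_le θ _ _).trans ?_
  simp

theorem abs_inner_scoreSum_le (hπ : π.ScoreBounded Mg Mh) (θ v : Param d) (τ : Traj S A H) :
    |inner ℝ (scoreSum π θ τ) v| ≤ H * Mg * ‖v‖ :=
  (abs_real_inner_le_norm _ _).trans
    (mul_le_mul_of_nonneg_right (norm_scoreSum_le hπ θ τ) (norm_nonneg v))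

theorem abs_logLikHess_le (hπ : π.ScoreBounded Mg Mh) (θ v : Param d) (τ : Traj S A H) :
    |logLikHess π θ v τ| ≤ H * Mh * ‖v‖ ^ 2 := by
  have h1 : ∀ h : Fin H, ‖inner ℝ (fderiv ℝ (fun θ' => π.score θ' (Traj.state τ h)
      (Traj.action τ h)) θ v) v‖ ≤ Mh * ‖v‖ ^ 2 := by
    intro h
    refine (norm_inner_le_norm _ _).trans ?_
    rw [pow_two, ← mul_assoc]
    refine mul_le_mul_of_nonneg_right ?_ (norm_nonneg v)
    exact (ContinuousLinearMap.le_opNorm _ _).trans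
      (mul_le_mul_of_nonneg_right (hπ.norm_hessian_le θ _ _) (norm_nonneg v))
  refine (norm_sum_le_of_le _ fun h _ => h1 h).trans ?_
  simp [mul_assoc]

end Likelihood

/-! ### Means over trajectories -/

theorem sum_fin_succ_pi {α E : Type*} [Fintype α] [AddCommMonoid E] {n : ℕ}
    (F : (Fin (n + 1) → α) → E) :
    ∑ x, F x = ∑ y : Fin n → α, ∑ a, F (Fin.snoc (α := fun _ => α) y a) := by
  rw [← (Fin.snocEquiv (fun _ : Fin (n + 1) => α)).sum_comp, Fintype.sum_prod_type_right]
  rfl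

section TrajMean

variable {S A : Type*} [Fintype S] [Fintype A] {d : ℕ}

/-- The trajectory without its last step. -/
def Traj.init {H : ℕ} (τ : Traj S A (H + 1)) : Traj S A H := (Fin.init τ.1, Fin.init τ.2)

theorem trajProb_succ (M : MDP S A) (ρ : S → ℝ) (π : PolicyClass S A d) {H : ℕ} (θ : Param d)
    (τ : Traj S A (H + 1)) :
    trajProb M ρ π θ τ = trajProb M ρ π θ (Traj.init τ) *
      (π.prob θ (Traj.state τ (Fin.last H)) (Traj.action τ (Fin.last H)) *
        M.P (Traj.state τ (Fin.last H)) (Traj.action τ (Fin.last H))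
          (Traj.nextState τ (Fin.last H))) := by
  rw [trajProb, Fin.prod_univ_castSucc, ← mul_assoc]
  rfl

/-- Marginalization of the last step of a trajectory. -/
theorem sum_trajProb_smul_init (M : MDP S A) (ρ : S → ℝ) (π : PolicyClass S A d) {H : ℕ}
    (θ : Param d) {E : Type*} [AddCommGroup E] [Module ℝ E] (F : Traj S A H → E) :
    ∑ τ : Traj S A (H + 1), trajProb M ρ π θ τ • F (Traj.init τ) =
      ∑ τ : Traj S A H, trajProb M ρ π θ τ • F τ := by
  rw [Fintype.sum_prod_type, Fintype.sum_prod_type, sum_fin_succ_pi]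
  refine Finset.sum_congr rfl fun x _ => ?_
  rw [Finset.sum_comm, sum_fin_succ_pi]
  refine Finset.sum_congr rfl fun y _ => ?_
  have h : ∀ (a : A) (s : S),
      trajProb M ρ π θ ((Fin.snoc (α := fun _ => S) x s, Fin.snoc (α := fun _ => A) y a) :
          Traj S A (H + 1)) •
        F (Traj.init ((Fin.snoc (α := fun _ => S) x s, Fin.snoc (α := fun _ => A) y a) :
          Traj S A (H + 1))) =
      (π.prob θ (x (Fin.last H)) a * M.P (x (Fin.last H)) a s) •
        (trajProb M ρ π θ ((x, y) : Traj S A H) • F (x, y)) := by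
    intro a s
    rw [trajProb_succ, smul_smul, mul_comm]
    simp [Traj.init, Traj.state, Traj.action, Traj.nextState, -Fin.castSucc_succ]
  simp_rw [h, ← Finset.sum_smul, ← Finset.mul_sum, (M.P_mem _ _).2, mul_one, π.sum_prob, one_smul]

variable {M : MDP S A} {ρ : S → ℝ} {π : PolicyClass S A d} {H : ℕ} {Mg Mh : ℝ}

theorem sum_trajProb (hρ : ρ ∈ stdSimplex ℝ S) (θ : Param d) :
    ∑ τ : Traj S A H, trajProb M ρ π θ τ = 1 := by
  induction H with
  | zero =>
    rw [Fintype.sum_prod_type, ← hρ.2, sum_fin_succ_pi]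
    simp [trajProb, Fin.snoc]
  | succ H ih =>
    have := sum_trajProb_smul_init (H := H) M ρ π θ (fun _ => (1 : ℝ))
    simpa [ih] using this

/-- The log-derivative trick: the environment factor of the likelihood does not depend on `θ`, so
`∇p = p ∇ log p` and `∇ log p` is the score sum. -/
theorem hasGradientAt_trajMean (hπ : π.ScoreBounded Mg Mh) (θ : Param d) (f : Traj S A H → ℝ) :
    HasGradientAt (fun θ => trajMean M ρ π θ f)
      (∑ τ, (trajProb M ρ π θ τ * f τ) • scoreSum π θ τ) θ := by
  rw [hasGradientAt_iff_hasFDerivAt, map_sum]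
  refine HasFDerivAt.fun_sum fun τ _ => ?_
  simp only [trajProb_eq]
  have h1 := (((hasGradientAt_logLik hπ θ τ).hasFDerivAt.exp).const_mul (envWeight M ρ τ)).mul_const
    (f τ)
  refine h1.congr_fderiv ?_
  ext v
  simp
  ring

/-- The total mass is constantly `1`, so its gradient vanishes. -/
theorem sum_trajProb_smul_scoreSum (hρ : ρ ∈ stdSimplex ℝ S) (hπ : π.ScoreBounded Mg Mh)
    (θ : Param d) : ∑ τ : Traj S A H, trajProb M ρ π θ τ • scoreSum π θ τ = 0 := by
  have h1 := hasGradientAt_trajMean (M := M) (ρ := ρ) hπ θ (fun _ : Traj S A H => (1 : ℝ))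
  have h2 : (fun θ => trajMean M ρ π θ (fun _ : Traj S A H => (1 : ℝ))) = fun _ => 1 := by
    funext θ
    simp [trajMean, sum_trajProb hρ]
  rw [h2] at h1
  simpa using h1.unique (hasGradientAt_const θ (1 : ℝ))

/-- The second-order lower bound for the mean of a bounded function of the trajectory. -/
theorem le_trajMean_add (hρ : ρ ∈ stdSimplex ℝ S) (hπ : π.ScoreBounded Mg Mh) (θ v : Param d)
    {f : Traj S A H → ℝ} {c : ℝ} (hc : 0 ≤ c) (hf : ∀ τ, |f τ| ≤ c) :
    trajMean M ρ π θ f + inner ℝ (∑ τ, (trajProb M ρ π θ τ * f τ) • scoreSum π θ τ) v -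
        c * ((H : ℝ) ^ 2 * Mg ^ 2 + H * Mh) / 2 * ‖v‖ ^ 2 ≤
      trajMean M ρ π (θ + v) f := by
  -- The upper Taylor bound is applied to the negative of the mean, along `s ↦ θ + s v`; this
  -- accounts for the minus signs. The second derivative of `p` is `p` times (log-likelihood Hessian
  -- plus squared score), and the mass of `p` is `1`.
  have hd := hasDerivAt_sum_exp (fun τ : Traj S A H => -(envWeight M ρ τ * f τ)) 1
    (fun τ s => hasDerivAt_logLik_line hπ θ v τ s)
  have hd' := hasDerivAt_sum_exp' (fun τ : Traj S A H => -(envWeight M ρ τ * f τ)) 1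
    (fun τ s => hasDerivAt_logLik_line hπ θ v τ s) (fun τ s => hasDerivAt_scoreSum_line hπ θ v τ s)
  have key := le_taylor_of_second_deriv_le (K := c * ((H : ℝ) ^ 2 * Mg ^ 2 + H * Mh) * ‖v‖ ^ 2)
    hd hd' ?_ (s := 1) ⟨zero_le_one, le_rfl⟩
  · have e : ∀ θ : Param d, ∑ τ : Traj S A H, -(envWeight M ρ τ * f τ) *
        Real.exp (logLik π θ τ) = -trajMean M ρ π θ f := by
      intro θ
      rw [trajMean, ← Finset.sum_neg_distrib]
      refine Finset.sum_congr rfl fun τ _ => ?_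
      rw [trajProb_eq]
      ring
    have e' : ∑ τ : Traj S A H, -(envWeight M ρ τ * f τ) *
        (inner ℝ (scoreSum π θ τ) v * Real.exp (logLik π θ τ)) =
        -inner ℝ (∑ τ, (trajProb M ρ π θ τ * f τ) • scoreSum π θ τ) v := by
      rw [sum_inner, ← Finset.sum_neg_distrib]
      refine Finset.sum_congr rfl fun τ _ => ?_
      rw [trajProb_eq, real_inner_smul_left]
      ring
    simp only [one_mul, zero_smul, one_smul, add_zero, mul_one, one_pow, e, e'] at key
    linarith
  · intro s _
    calc ∑ τ : Traj S A H, -(envWeight M ρ τ * f τ) *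
          ((1 * logLikHess π (θ + s • v) v τ + (1 * inner ℝ (scoreSum π (θ + s • v) τ) v) ^ 2) *
            Real.exp (1 * logLik π (θ + s • v) τ))
        ≤ ∑ τ : Traj S A H, trajProb M ρ π (θ + s • v) τ *
          (c * ((H : ℝ) ^ 2 * Mg ^ 2 + H * Mh) * ‖v‖ ^ 2) := by
          refine Finset.sum_le_sum fun τ _ => ?_
          set q := logLikHess π (θ + s • v) v τ + inner ℝ (scoreSum π (θ + s • v) τ) v ^ 2 with hq
          have hqb : |q| ≤ ((H : ℝ) ^ 2 * Mg ^ 2 + H * Mh) * ‖v‖ ^ 2 := by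
            have h1 := abs_logLikHess_le hπ (θ + s • v) v τ
            have h2 := abs_inner_scoreSum_le hπ (θ + s • v) v τ
            have h3 := pow_le_pow_left₀ (abs_nonneg _) h2 2
            rw [← abs_pow] at h3
            calc |q| ≤ _ := abs_add_le _ _
              _ ≤ _ := add_le_add h1 h3
              _ = _ := by ring
          have hfq : -(f τ * q) ≤ c * (((H : ℝ) ^ 2 * Mg ^ 2 + H * Mh) * ‖v‖ ^ 2) := by
            refine (neg_le_abs _).trans ?_
            rw [abs_mul]
            exact mul_le_mul (hf τ) hqb (abs_nonneg _) hc
          calc _ = trajProb M ρ π (θ + s • v) τ * (-(f τ * q)) := by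
                rw [trajProb_eq, hq]
                ring_nf
            _ ≤ _ := by
                rw [mul_assoc c]
                exact mul_le_mul_of_nonneg_left hfq (trajProb_nonneg hρ _ τ)
      _ = _ := by rw [← Finset.sum_mul, sum_trajProb hρ, one_mul]

/-! ### The truncated value function and the policy gradient estimator -/

/-- The discounted reward of the last step. -/
def lastReward (M : MDP S A) {H : ℕ} (τ : Traj S A (H + 1)) : ℝ :=
  M.γ ^ H * M.r (Traj.state τ (Fin.last H)) (Traj.action τ (Fin.last H))

theorem abs_lastReward_le (τ : Traj S A (H + 1)) : |lastReward M τ| ≤ M.γ ^ H := by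
  have h1 := M.r_mem (Traj.state τ (Fin.last H)) (Traj.action τ (Fin.last H))
  have h2 := pow_nonneg M.γ_mem.1.le H
  rw [lastReward, abs_of_nonneg (mul_nonneg h2 h1.1)]
  exact mul_le_of_le_one_right h2 h1.2

theorem truncValue_succ (θ : Param d) :
    truncValue M ρ π (H + 1) θ = truncValue M ρ π H θ +
      trajMean M ρ π θ (fun τ : Traj S A (H + 1) => lastReward M τ) := by
  have h1 := sum_trajProb_smul_init M ρ π θ (fun τ : Traj S A H =>
    ∑ h : Fin H, M.γ ^ (h : ℕ) * M.r (Traj.state τ h) (Traj.action τ h))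
  simp only [smul_eq_mul] at h1
  rw [truncValue, truncValue, trajMean, trajMean, ← h1, trajMean, ← Finset.sum_add_distrib]
  refine Finset.sum_congr rfl fun τ _ => ?_
  rw [Fin.sum_univ_castSucc, mul_add]
  rfl

theorem gpomdp_succ (b : Fin (H + 1) → ℝ) (θ : Param d) (τ : Traj S A (H + 1)) :
    gpomdp M π b θ τ = gpomdp M π (Fin.init b) θ (Traj.init τ) +
      (lastReward M τ - b (Fin.last H)) • scoreSum π θ τ := by
  rw [gpomdp, Fin.sum_univ_castSucc]
  congr 1
  · refine Finset.sum_congr rfl fun h _ => ?_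
    rw [← Fin.map_castSuccEmb_Iic, Finset.sum_map]
    rfl
  · have : Finset.Iic (Fin.last H) = Finset.univ := Finset.Iic_top
    rw [this, ← Finset.smul_sum]
    rfl

/-- The estimator is unbiased. -/
theorem hasGradientAt_truncValue (hρ : ρ ∈ stdSimplex ℝ S) (hπ : π.ScoreBounded Mg Mh)
    (b : Fin H → ℝ) (θ : Param d) :
    HasGradientAt (truncValue M ρ π H) (∑ τ, trajProb M ρ π θ τ • gpomdp M π b θ τ) θ := by
  induction H with
  | zero =>
    have : truncValue M ρ π 0 = fun _ => 0 := by funext; simp [truncValue, trajMean]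
    rw [this]
    simpa [gpomdp] using hasGradientAt_const θ (0 : ℝ)
  | succ H ih =>
    have h1 := (ih (Fin.init b)).hasFDerivAt.add
      (hasGradientAt_trajMean (M := M) (ρ := ρ) hπ θ
        (fun τ : Traj S A (H + 1) => lastReward M τ)).hasFDerivAt
    rw [hasGradientAt_iff_hasFDerivAt]
    have h2 : truncValue M ρ π (H + 1) = (truncValue M ρ π H) + fun θ => trajMean M ρ π θ
        (fun τ : Traj S A (H + 1) => lastReward M τ) := funext fun θ => truncValue_succ θ
    rw [h2]
    refine h1.congr_fderiv ?_
    rw [← map_add]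
    congr 1
    rw [← sum_trajProb_smul_init M ρ π θ]
    -- The baseline multiplies the score of the whole trajectory, which has mean zero, so it does
    -- not change the mean of the estimator.
    have h3 := sum_trajProb_smul_scoreSum (M := M) (H := H + 1) hρ hπ θ
    have h4 : ∑ τ : Traj S A (H + 1), (trajProb M ρ π θ τ * lastReward M τ) • scoreSum π θ τ =
        ∑ τ : Traj S A (H + 1), trajProb M ρ π θ τ •
          ((lastReward M τ - b (Fin.last H)) • scoreSum π θ τ) := by
      rw [← sub_eq_zero, ← Finset.sum_sub_distrib]
      calc _ = ∑ τ : Traj S A (H + 1), b (Fin.last H) • (trajProb M ρ π θ τ • scoreSum π θ τ) := by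
            refine Finset.sum_congr rfl fun τ _ => ?_
            module
        _ = 0 := by rw [← Finset.smul_sum, h3, smul_zero]
    rw [h4, ← Finset.sum_add_distrib]
    refine Finset.sum_congr rfl fun τ _ => ?_
    rw [gpomdp_succ, smul_add]

theorem sum_trajProb_smul_gpomdp (hρ : ρ ∈ stdSimplex ℝ S) (hπ : π.ScoreBounded Mg Mh)
    (b : Fin H → ℝ) (θ : Param d) :
    ∑ τ, trajProb M ρ π θ τ • gpomdp M π b θ τ = gradient (truncValue M ρ π H) θ :=
  (hasGradientAt_truncValue hρ hπ b θ).gradient.symm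

/-- The reward of step `h` depends only on the first `h + 1` steps, so its mean has curvature
governed by `h + 1` and not by the full horizon. The induction on `H` adds one reward at a time,
which keeps the final constant independent of `H`. -/
theorem le_truncValue_add_sum (hρ : ρ ∈ stdSimplex ℝ S) (hπ : π.ScoreBounded Mg Mh)
    (θ v : Param d) :
    truncValue M ρ π H θ + inner ℝ (gradient (truncValue M ρ π H) θ) v -
        (∑ h ∈ Finset.range H, M.γ ^ h * (((h : ℝ) + 1) ^ 2 * Mg ^ 2 + ((h : ℝ) + 1) * Mh)) / 2 *
          ‖v‖ ^ 2 ≤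
      truncValue M ρ π H (θ + v) := by
  induction H with
  | zero =>
    have : truncValue M ρ π 0 = fun _ => 0 := by funext; simp [truncValue, trajMean]
    rw [this, (hasGradientAt_const θ (0 : ℝ)).gradient]
    simp
  | succ H ih =>
    have h1 := le_trajMean_add (M := M) hρ hπ θ v (pow_nonneg M.γ_mem.1.le H)
      (fun τ : Traj S A (H + 1) => abs_lastReward_le (M := M) τ)
    have h2 : gradient (truncValue M ρ π (H + 1)) θ = gradient (truncValue M ρ π H) θ +
        ∑ τ : Traj S A (H + 1), (trajProb M ρ π θ τ * lastReward M τ) • scoreSum π θ τ := by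
      rw [← sum_trajProb_smul_gpomdp hρ hπ 0, ← sum_trajProb_smul_gpomdp hρ hπ 0,
        ← sum_trajProb_smul_init M ρ π θ (fun τ : Traj S A H => gpomdp M π 0 θ τ),
        ← Finset.sum_add_distrib]
      refine Finset.sum_congr rfl fun τ _ => ?_
      rw [gpomdp_succ, smul_add, smul_smul]
      simp only [Pi.zero_apply, sub_zero]
      rfl
    rw [truncValue_succ, truncValue_succ, h2, inner_add_left, Finset.sum_range_succ]
    push_cast at h1
    linarith

/-- The value function is `L`-smooth. -/
theorem le_truncValue_add (hρ : ρ ∈ stdSimplex ℝ S) (hπ : π.ScoreBounded Mg Mh) (hMh : 0 ≤ Mh)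
    (θ v : Param d) :
    truncValue M ρ π H θ + inner ℝ (gradient (truncValue M ρ π H) θ) v -
        (2 * Mg ^ 2 / (1 - M.γ) ^ 3 + Mh / (1 - M.γ) ^ 2) / 2 * ‖v‖ ^ 2 ≤
      truncValue M ρ π H (θ + v) := by
  refine le_trans ?_ (le_truncValue_add_sum hρ hπ θ v)
  have h1 := mul_le_mul_of_nonneg_right (sum_sq_mul_pow_le M.γ_mem H) (sq_nonneg Mg)
  have h2 := mul_le_mul_of_nonneg_right (sum_mul_pow_le M.γ_mem H) hMh
  rw [Finset.sum_mul] at h1 h2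
  have h3 : ∑ h ∈ Finset.range H, M.γ ^ h * (((h : ℝ) + 1) ^ 2 * Mg ^ 2 + ((h : ℝ) + 1) * Mh) ≤
      2 * Mg ^ 2 / (1 - M.γ) ^ 3 + Mh / (1 - M.γ) ^ 2 := by
    calc _ = ∑ h ∈ Finset.range H, ((h : ℝ) + 1) ^ 2 * M.γ ^ h * Mg ^ 2 +
          ∑ h ∈ Finset.range H, ((h : ℝ) + 1) * M.γ ^ h * Mh := by
          rw [← Finset.sum_add_distrib]
          exact Finset.sum_congr rfl fun h _ => by ring
      _ ≤ _ := add_le_add h1 h2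
      _ = _ := by ring
  have := mul_le_mul_of_nonneg_right h3 (sq_nonneg ‖v‖)
  linarith

theorem truncValue_mem (hρ : ρ ∈ stdSimplex ℝ S) (θ : Param d) :
    truncValue M ρ π H θ ∈ Set.Icc 0 (1 / (1 - M.γ)) := by
  have hr : ∀ (h : ℕ) s a, 0 ≤ M.γ ^ h * M.r s a ∧ M.γ ^ h * M.r s a ≤ M.γ ^ h := fun h s a =>
    ⟨mul_nonneg (pow_nonneg M.γ_mem.1.le h) (M.r_mem s a).1,
      mul_le_of_le_one_right (pow_nonneg M.γ_mem.1.le h) (M.r_mem s a).2⟩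
  constructor
  · exact Finset.sum_nonneg fun τ _ => mul_nonneg (trajProb_nonneg hρ θ τ)
      (Finset.sum_nonneg fun h _ => (hr h _ _).1)
  · calc _ ≤ ∑ τ : Traj S A H, trajProb M ρ π θ τ * (1 / (1 - M.γ)) := by
          refine Finset.sum_le_sum fun τ _ => mul_le_mul_of_nonneg_left ?_ (trajProb_nonneg hρ θ τ)
          refine le_trans ?_ (sum_pow_le M.γ_mem H)
          rw [← Fin.sum_univ_eq_sum_range (fun h => M.γ ^ h)]
          exact Finset.sum_le_sum fun h _ => (hr h _ _).2
      _ = _ := by rw [← Finset.sum_mul, sum_trajProb hρ, one_mul]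

/-- Used with `x` the scores to bound the estimator, and with `x` differences of scores to get its
Lipschitz constant. -/
theorem norm_sum_smul_le {b : Fin H → ℝ}
    (hb : ∀ (h : Fin H) (s : S) (a : A), |M.γ ^ (h : ℕ) * M.r s a - b h| ≤ M.γ ^ (h : ℕ))
    (τ : Traj S A H) {x : Fin H → Param d} {C : ℝ} (hC : 0 ≤ C) (hx : ∀ j, ‖x j‖ ≤ C) :
    ‖∑ h : Fin H, ∑ j ∈ Finset.Iic h,
      (M.γ ^ (h : ℕ) * M.r (Traj.state τ h) (Traj.action τ h) - b h) • x j‖ ≤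
      C / (1 - M.γ) ^ 2 := by
  calc _ ≤ ∑ h : Fin H, ((h : ℝ) + 1) * M.γ ^ (h : ℕ) * C := by
        refine norm_sum_le_of_le _ fun h _ => ?_
        refine (norm_sum_le _ _).trans
          ((Finset.sum_le_sum (g := fun _ => M.γ ^ (h : ℕ) * C) fun j _ => ?_).trans ?_)
        · rw [norm_smul, Real.norm_eq_abs]
          exact mul_le_mul (hb h _ _) (hx j) (norm_nonneg _) (pow_nonneg M.γ_mem.1.le _)
        · simp [mul_assoc]
    _ = (∑ h ∈ Finset.range H, ((h : ℝ) + 1) * M.γ ^ h) * C := by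
        rw [Finset.sum_mul, ← Fin.sum_univ_eq_sum_range (fun h => ((h : ℝ) + 1) * M.γ ^ h * C)]
    _ ≤ 1 / (1 - M.γ) ^ 2 * C := mul_le_mul_of_nonneg_right (sum_mul_pow_le M.γ_mem H) hC
    _ = _ := by ring

theorem norm_gpomdp_le (hπ : π.ScoreBounded Mg Mh) (hMg : 0 ≤ Mg) {b : Fin H → ℝ}
    (hb : ∀ (h : Fin H) (s : S) (a : A), |M.γ ^ (h : ℕ) * M.r s a - b h| ≤ M.γ ^ (h : ℕ))
    (θ : Param d) (τ : Traj S A H) : ‖gpomdp M π b θ τ‖ ≤ Mg / (1 - M.γ) ^ 2 :=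
  norm_sum_smul_le hb τ hMg fun _ => hπ.norm_score_le _ _ _

theorem norm_gpomdp_sub_le (hπ : π.ScoreBounded Mg Mh) (hMh : 0 ≤ Mh) {b : Fin H → ℝ}
    (hb : ∀ (h : Fin H) (s : S) (a : A), |M.γ ^ (h : ℕ) * M.r s a - b h| ≤ M.γ ^ (h : ℕ))
    (θ θ' : Param d) (τ : Traj S A H) :
    ‖gpomdp M π b θ τ - gpomdp M π b θ' τ‖ ≤ Mh / (1 - M.γ) ^ 2 * ‖θ - θ'‖ := by
  rw [div_mul_eq_mul_div, gpomdp, gpomdp]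
  simp only [← Finset.sum_sub_distrib, ← smul_sub]
  refine norm_sum_smul_le hb τ (x := fun j => π.score θ (Traj.state τ j) (Traj.action τ j) -
    π.score θ' (Traj.state τ j) (Traj.action τ j)) (mul_nonneg hMh (norm_nonneg _)) fun j => ?_
  exact convex_univ.norm_image_sub_le_of_norm_fderiv_le
    (f := fun θ => π.score θ (Traj.state τ j) (Traj.action τ j))
    (fun x _ => (hπ.differentiable_score _ _).differentiableAt)
    (fun x _ => hπ.norm_hessian_le x _ _) (Set.mem_univ _) (Set.mem_univ _)

end TrajMean

/-! ### The variance of the importance sampling weights -/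

section WeightVariance

variable {S A : Type*} [Fintype S] [Fintype A] {d : ℕ}
  {M : MDP S A} {ρ : S → ℝ} {π : PolicyClass S A d} {H : ℕ} {Mg Mh : ℝ}

theorem trajMean_isWeight (hρ : ρ ∈ stdSimplex ℝ S) (θ' θ : Param d) :
    trajMean M ρ π θ (isWeight (H := H) π θ' θ) = 1 := by
  simp_rw [trajMean, trajProb_mul_isWeight, sum_trajProb hρ]

theorem trajVar_isWeight (hρ : ρ ∈ stdSimplex ℝ S) (θ' θ : Param d) :
    trajVar M ρ π θ (isWeight (H := H) π θ' θ) =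
      ∑ τ : Traj S A H, trajProb M ρ π θ τ * isWeight π θ' θ τ ^ 2 - 1 := by
  have h1 := trajMean_isWeight (M := M) (π := π) (H := H) hρ θ' θ
  rw [trajVar, h1]
  rw [trajMean] at h1 ⊢
  calc _ = ∑ τ : Traj S A H, trajProb M ρ π θ τ * isWeight π θ' θ τ ^ 2 -
        2 * ∑ τ : Traj S A H, trajProb M ρ π θ τ * isWeight π θ' θ τ +
        ∑ τ : Traj S A H, trajProb M ρ π θ τ := by
        rw [Finset.mul_sum, ← Finset.sum_sub_distrib, ← Finset.sum_add_distrib]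
        exact Finset.sum_congr rfl fun τ _ => by ring
    _ = _ := by rw [h1, sum_trajProb hρ]; ring

/-- A bound on the variance of the weights improves to one that is quadratic in the distance of
the parameters. -/
theorem trajVar_isWeight_le (hρ : ρ ∈ stdSimplex ℝ S) (hπ : π.ScoreBounded Mg Mh) (hMh : 0 ≤ Mh)
    {W : ℝ} (hW : 0 ≤ W) (θ' θ : Param d)
    (h : trajVar M ρ π θ (isWeight (H := H) π θ' θ) ≤ W) :
    trajVar M ρ π θ (isWeight (H := H) π θ' θ) ≤
      H * (2 * H * Mg ^ 2 + Mh) * (W + 1) * ‖θ' - θ‖ ^ 2 := by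
  set v := θ' - θ with hv
  set a := H * (2 * H * Mg ^ 2 + Mh) * ‖v‖ ^ 2 with ha
  -- `f s` is the second moment of the weight of `θ + s v` against `θ`: `f 0 = 1`, `f' 0 = 0` and
  -- `f'' ≤ 2 a f`.
  set f : ℝ → ℝ := fun s => ∑ τ : Traj S A H, trajProb M ρ π θ τ *
    Real.exp (2 * (logLik π (θ + s • v) τ - logLik π θ τ)) with hf
  have hφ : ∀ (τ : Traj S A H) (s : ℝ), HasDerivAt
      (fun s : ℝ => logLik π (θ + s • v) τ - logLik π θ τ)
      (inner ℝ (scoreSum π (θ + s • v) τ) v) s := fun τ s =>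
    (hasDerivAt_logLik_line hπ θ v τ s).sub_const _
  have hd := hasDerivAt_sum_exp (fun τ : Traj S A H => trajProb M ρ π θ τ) 2 hφ
  have hd' := hasDerivAt_sum_exp' (fun τ : Traj S A H => trajProb M ρ π θ τ) 2 hφ
    (fun τ s => hasDerivAt_scoreSum_line hπ θ v τ s)
  have hf0 : f 0 = 1 := by simp [hf, sum_trajProb hρ]
  have hf1 : f 1 = trajVar M ρ π θ (isWeight (H := H) π θ' θ) + 1 := by
    rw [trajVar_isWeight hρ, sub_add_cancel, hf]
    refine Finset.sum_congr rfl fun τ _ => ?_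
    rw [isWeight_eq, ← Real.exp_nat_mul, one_smul, hv, add_sub_cancel]
    rfl
  have hd0 : ∑ τ : Traj S A H, trajProb M ρ π θ τ * (2 * inner ℝ (scoreSum π (θ + (0 : ℝ) • v) τ) v *
      Real.exp (2 * (logLik π (θ + (0 : ℝ) • v) τ - logLik π θ τ))) = 0 := by
    have := congrArg (fun x => 2 * inner ℝ x v)
      (sum_trajProb_smul_scoreSum (M := M) (H := H) hρ hπ θ)
    simp only [inner_zero_left, mul_zero, sum_inner, real_inner_smul_left, Finset.mul_sum] at this
    refine Eq.trans ?_ this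
    refine Finset.sum_congr rfl fun τ _ => ?_
    simp
    ring
  have hpos : ∀ s, 0 ≤ f s := fun s => Finset.sum_nonneg fun τ _ =>
    mul_nonneg (trajProb_nonneg hρ θ τ) (Real.exp_pos _).le
  have hdd : ∀ s : ℝ, ∑ τ : Traj S A H, trajProb M ρ π θ τ *
      ((2 * logLikHess π (θ + s • v) v τ + (2 * inner ℝ (scoreSum π (θ + s • v) τ) v) ^ 2) *
        Real.exp (2 * (logLik π (θ + s • v) τ - logLik π θ τ))) ≤ 2 * a * f s := by
    intro s
    rw [hf, Finset.mul_sum]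
    refine Finset.sum_le_sum fun τ _ => ?_
    rw [mul_left_comm (2 * a)]
    refine mul_le_mul_of_nonneg_left ?_ (trajProb_nonneg hρ θ τ)
    refine mul_le_mul_of_nonneg_right ?_ (Real.exp_pos _).le
    have h1 := (le_abs_self _).trans (abs_logLikHess_le hπ (θ + s • v) v τ)
    have h2 := pow_le_pow_left₀ (abs_nonneg _) (abs_inner_scoreSum_le hπ (θ + s • v) v τ) 2
    rw [sq_abs] at h2
    rw [ha]
    nlinarith
  have ha0 : 0 ≤ a := by positivity
  -- The variance is controlled only at `s = 1`, not at intermediate points. Comparing `f` with its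
  -- own maximum gives `f s₀ ≤ 1 + a f s₀` without any bound inside the segment.
  obtain ⟨s₀, hs₀, hmax⟩ := isCompact_Icc.exists_isMaxOn
    (Set.nonempty_Icc.2 (zero_le_one (α := ℝ)))
    (f := f) (fun s _ => (hd s).continuousAt.continuousWithinAt)
  have hF : f s₀ ≤ 1 + a * f s₀ := by
    have h1 := le_taylor_of_second_deriv_le (K := 2 * a * f s₀) hd hd'
      (fun s hs => (hdd s).trans
        (mul_le_mul_of_nonneg_left (hmax hs) (by linarith))) hs₀
    rw [hd0] at h1
    have h2 : s₀ ^ 2 ≤ 1 := pow_le_one₀ hs₀.1 hs₀.2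
    have h3 : 0 ≤ a * f s₀ := mul_nonneg ha0 (hpos _)
    change f s₀ ≤ f 0 + _ + _ at h1
    nlinarith
  have hF1 : f 1 ≤ f s₀ := hmax (Set.right_mem_Icc.2 zero_le_one)
  -- If `a ≥ 1`, the assumed bound `W` already suffices. If `a < 1`, then `f 1 ≤ f s₀` gives `(1 -
  -- a) f 1 ≤ 1`, so the variance is at most `a f 1 ≤ a (W + 1)`.
  have goal : trajVar M ρ π θ (isWeight (H := H) π θ' θ) ≤ a * (W + 1) := by
    rcases le_or_gt 1 a with h1 | h1
    · nlinarith
    · nlinarith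
  calc _ ≤ _ := goal
    _ = _ := by rw [ha]; ring

end WeightVariance

/-! ### The variance of batch averages -/

section Batch

variable {ι E : Type*} [Fintype ι] [NormedAddCommGroup E] [InnerProductSpace ℝ E]

theorem sum_prod_eq_one {p : ι → ℝ} (hp : ∑ i, p i = 1) (B : ℕ) :
    ∑ D : Fin B → ι, ∏ j, p (D j) = 1 := by
  induction B with
  | zero => simp
  | succ B ih =>
    rw [sum_fin_succ_pi]
    simp [Fin.prod_univ_castSucc, ← Finset.mul_sum, hp, ih]

theorem sum_mul_norm_add_sq {p : ι → ℝ} (hp : ∑ i, p i = 1) (X : ι → E) (v : E) :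
    ∑ i, p i * ‖v + X i‖ ^ 2 =
      ‖v‖ ^ 2 + 2 * inner ℝ v (∑ i, p i • X i) + ∑ i, p i * ‖X i‖ ^ 2 := by
  have h1 : ‖v‖ ^ 2 = ∑ i, p i * ‖v‖ ^ 2 := by rw [← Finset.sum_mul, hp, one_mul]
  rw [h1, inner_sum, Finset.mul_sum, ← Finset.sum_add_distrib, ← Finset.sum_add_distrib]
  refine Finset.sum_congr rfl fun i _ => ?_
  rw [norm_add_sq_real, real_inner_smul_right]
  ring

/-- Independent centred terms are orthogonal in mean square; peeling off one sample at a time kills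
the cross term. -/
theorem sum_prod_mul_norm_add_sum_sq {p : ι → ℝ} (hp : ∑ i, p i = 1) {X : ι → E}
    (hX : ∑ i, p i • X i = 0) (v : E) (B : ℕ) :
    ∑ D : Fin B → ι, (∏ j, p (D j)) * ‖v + ∑ j, X (D j)‖ ^ 2 =
      ‖v‖ ^ 2 + B * ∑ i, p i * ‖X i‖ ^ 2 := by
  induction B with
  | zero => simp
  | succ B ih =>
    rw [sum_fin_succ_pi]
    have h : ∀ y : Fin B → ι, ∑ i, (∏ j, p (Fin.snoc (α := fun _ => ι) y i j)) *
        ‖v + ∑ j, X (Fin.snoc (α := fun _ => ι) y i j)‖ ^ 2 =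
        (∏ j, p (y j)) * ‖v + ∑ j, X (y j)‖ ^ 2 +
          (∏ j, p (y j)) * ∑ i, p i * ‖X i‖ ^ 2 := by
      intro y
      simp only [Fin.prod_univ_castSucc, Fin.sum_univ_castSucc, Fin.snoc_castSucc, Fin.snoc_last,
        mul_assoc, ← Finset.mul_sum, ← add_assoc]
      rw [sum_mul_norm_add_sq hp, hX, inner_zero_right]
      ring
    simp_rw [h]
    rw [Finset.sum_add_distrib, ih, ← Finset.sum_mul, sum_prod_eq_one hp]
    push_cast
    ring

theorem sum_mul_norm_sub_mean_sq_le {p : ι → ℝ} (hp : ∑ i, p i = 1) (X : ι → E) :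
    ∑ i, p i * ‖X i - ∑ j, p j • X j‖ ^ 2 ≤ ∑ i, p i * ‖X i‖ ^ 2 := by
  set μ := ∑ j, p j • X j with hμ
  have h := sum_mul_norm_add_sq hp X (-μ)
  rw [← hμ, inner_neg_left, real_inner_self_eq_norm_sq, norm_neg] at h
  simp only [neg_add_eq_sub] at h
  rw [h]
  nlinarith [sq_nonneg ‖μ‖]

/-- The mean square deviation of `v + (1/B) ∑_j X(i_j)` for independent `i_1, …, i_B`. -/
theorem sum_prod_mul_norm_average_sq_le {p : ι → ℝ} (hp : ∑ i, p i = 1) (X : ι → E) (v : E)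
    {B : ℕ} (hB : 1 ≤ B) :
    ∑ D : Fin B → ι, (∏ j, p (D j)) *
        ‖v + (1 / (B : ℝ)) • ∑ j, X (D j) - ∑ i, p i • X i‖ ^ 2 ≤
      ‖v‖ ^ 2 + (∑ i, p i * ‖X i‖ ^ 2) / B := by
  have hB' : (0 : ℝ) < B := by exact_mod_cast hB
  set μ := ∑ j, p j • X j with hμ
  have h0 : ∑ i, p i • ((1 / (B : ℝ)) • (X i - μ)) = 0 := by
    simp_rw [smul_comm _ (1 / (B : ℝ)), ← Finset.smul_sum, smul_sub, Finset.sum_sub_distrib,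
      ← Finset.sum_smul, hp, one_smul, ← hμ, sub_self, smul_zero]
  have h1 := sum_prod_mul_norm_add_sum_sq hp h0 v B
  have h2 : ∀ D : Fin B → ι, v + ∑ j, (1 / (B : ℝ)) • (X (D j) - μ) =
      v + (1 / (B : ℝ)) • ∑ j, X (D j) - μ := by
    intro D
    rw [← Finset.smul_sum, Finset.sum_sub_distrib, smul_sub, Finset.sum_const, Finset.card_univ,
      Fintype.card_fin, ← Nat.cast_smul_eq_nsmul ℝ, smul_smul, one_div_mul_cancel hB'.ne', one_smul,
      add_sub_assoc]
  simp_rw [h2] at h1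
  rw [h1]
  have h3 := sum_mul_norm_sub_mean_sq_le hp X
  rw [← hμ] at h3
  have h4 : ∀ i, p i * ‖(1 / (B : ℝ)) • (X i - μ)‖ ^ 2 =
      (1 / (B : ℝ)) ^ 2 * (p i * ‖X i - μ‖ ^ 2) := by
    intro i
    rw [norm_smul, mul_pow, Real.norm_eq_abs, sq_abs]
    ring
  simp_rw [h4, ← Finset.mul_sum]
  have h5 : (B : ℝ) * ((1 / (B : ℝ)) ^ 2 * ∑ i, p i * ‖X i - μ‖ ^ 2) =
      (∑ i, p i * ‖X i - μ‖ ^ 2) / B := by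
    field_simp
  rw [h5]
  gcongr

end Batch

/-! ### Means over runs of the algorithm -/

section Run

variable {S A : Type*} [Fintype S] [Fintype A] {d : ℕ}

/-- The mean of a function of the memory of the algorithm after `n` iterations. -/
noncomputable def runMean (M : MDP S A) (ρ : S → ℝ) (π : PolicyClass S A d) {H : ℕ}
    (b : Fin H → ℝ) (k m c : ℝ) (B : ℕ) (θ₁ : Param d) (n : ℕ) (F : State d → ℝ) : ℝ :=
  ∑ ω : Fin n → Fin B → Traj S A H, runProb M ρ π b k m c θ₁ n ω * F (run M π b k m c θ₁ n ω)

variable {M : MDP S A} {ρ : S → ℝ} {π : PolicyClass S A d} {H : ℕ} {b : Fin H → ℝ} {k m c : ℝ}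
  {B : ℕ} {θ₁ : Param d}

theorem runProb_nonneg (hρ : ρ ∈ stdSimplex ℝ S) :
    ∀ (n : ℕ) (ω : Fin n → Fin B → Traj S A H), 0 ≤ runProb M ρ π b k m c θ₁ n ω
  | 0, _ => zero_le_one
  | n + 1, _ => mul_nonneg (runProb_nonneg hρ n _)
      (Finset.prod_nonneg fun _ _ => trajProb_nonneg hρ _ _)

theorem runMean_zero (F : State d → ℝ) : runMean M ρ π b k m c B θ₁ 0 F = F ⟨θ₁, θ₁, 0⟩ := by
  simp [runMean, runProb, run]

/-- The tower property: the last batch is averaged conditionally on the memory left by the earlier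
ones. -/
theorem runMean_succ (n : ℕ) (F : State d → ℝ) :
    runMean M ρ π b k m c B θ₁ (n + 1) F =
      runMean M ρ π b k m c B θ₁ n (fun x => ∑ D : Fin B → Traj S A H,
        (∏ i, trajProb M ρ π x.cur (D i)) * F (step M π b k m c (n + 1) x D)) := by
  rw [runMean, sum_fin_succ_pi, runMean]
  refine Finset.sum_congr rfl fun y _ => ?_
  rw [Finset.mul_sum]
  refine Finset.sum_congr rfl fun D _ => ?_
  simp [runProb, run, mul_assoc]

/-- The comparison is needed only on runs of positive probability, which is what allows an almost
sure variance bound. -/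
theorem runMean_mono (hρ : ρ ∈ stdSimplex ℝ S) {n : ℕ} {F G : State d → ℝ}
    (h : ∀ ω : Fin n → Fin B → Traj S A H, 0 < runProb M ρ π b k m c θ₁ n ω →
      F (run M π b k m c θ₁ n ω) ≤ G (run M π b k m c θ₁ n ω)) :
    runMean M ρ π b k m c B θ₁ n F ≤ runMean M ρ π b k m c B θ₁ n G := by
  refine Finset.sum_le_sum fun ω _ => ?_
  rcases (runProb_nonneg (M := M) (π := π) (b := b) (k := k) (m := m) (c := c) (θ₁ := θ₁)
    hρ n ω).eq_or_lt with h0 | h0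
  · rw [← h0, zero_mul, zero_mul]
  · exact mul_le_mul_of_nonneg_left (h ω h0) h0.le

theorem runMean_add (n : ℕ) (F G : State d → ℝ) :
    runMean M ρ π b k m c B θ₁ n (fun x => F x + G x) =
      runMean M ρ π b k m c B θ₁ n F + runMean M ρ π b k m c B θ₁ n G := by
  simp only [runMean, mul_add, Finset.sum_add_distrib]

theorem runMean_const_mul (n : ℕ) (r : ℝ) (F : State d → ℝ) :
    runMean M ρ π b k m c B θ₁ n (fun x => r * F x) = r * runMean M ρ π b k m c B θ₁ n F := by
  rw [runMean, runMean, Finset.mul_sum]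
  exact Finset.sum_congr rfl fun _ _ => by ring

theorem runMean_succ_prev (hρ : ρ ∈ stdSimplex ℝ S) (n : ℕ) (F : Param d → ℝ) :
    runMean M ρ π b k m c B θ₁ (n + 1) (fun x => F x.prev) =
      runMean M ρ π b k m c B θ₁ n (fun x => F x.cur) := by
  rw [runMean_succ]
  simp only [step, ← Finset.sum_mul]
  simp only [sum_prod_eq_one (sum_trajProb hρ _), one_mul]

theorem runMean_const (hρ : ρ ∈ stdSimplex ℝ S) (n : ℕ) (r : ℝ) :
    runMean M ρ π b k m c B θ₁ n (fun _ => r) = r := by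
  induction n with
  | zero => exact runMean_zero _
  | succ n ih => rw [runMean_succ_prev hρ n (fun _ => r), ih]

theorem runMean_nonneg (hρ : ρ ∈ stdSimplex ℝ S) {n : ℕ} {F : State d → ℝ} (hF : ∀ x, 0 ≤ F x) :
    0 ≤ runMean M ρ π b k m c B θ₁ n F :=
  Finset.sum_nonneg fun ω _ => mul_nonneg (runProb_nonneg hρ n ω) (hF _)

theorem sq_runMean_le (hρ : ρ ∈ stdSimplex ℝ S) (n : ℕ) (F : State d → ℝ) :
    runMean M ρ π b k m c B θ₁ n F ^ 2 ≤ runMean M ρ π b k m c B θ₁ n (fun x => F x ^ 2) := by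
  set μ := runMean M ρ π b k m c B θ₁ n F with hμ
  have h0 : 0 ≤ runMean M ρ π b k m c B θ₁ n (fun x => (F x - μ) ^ 2) :=
    runMean_nonneg hρ fun x => sq_nonneg _
  have h1 : (fun x => (F x - μ) ^ 2) = fun x => F x ^ 2 + ((-2 * μ) * F x + μ ^ 2) := by
    funext x
    ring
  rw [h1, runMean_add, runMean_add, runMean_const_mul, runMean_const hρ, ← hμ] at h0
  linarith

/-! ### One iteration -/

/-- Polarization writes `⟨∇J, u⟩` as half of `‖u‖² + ‖∇J‖² - ‖u - ∇J‖²`; the curvature term then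
costs at most half of `η/2 ‖u‖²`. -/
theorem truncValue_step_ge {L η : ℝ} (hη : 0 ≤ η) (hηL : L * η ≤ 1 / 2)
    (hL : ∀ θ v : Param d, truncValue M ρ π H θ + inner ℝ (gradient (truncValue M ρ π H) θ) v -
      L / 2 * ‖v‖ ^ 2 ≤ truncValue M ρ π H (θ + v)) (θ u : Param d) :
    truncValue M ρ π H θ + η / 2 * ‖gradient (truncValue M ρ π H) θ‖ ^ 2 + η / 4 * ‖u‖ ^ 2 -
        η / 2 * ‖u - gradient (truncValue M ρ π H) θ‖ ^ 2 ≤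
      truncValue M ρ π H (θ + η • u) := by
  have h1 := hL θ (η • u)
  rw [real_inner_smul_right, norm_smul, mul_pow, Real.norm_eq_abs, sq_abs] at h1
  have h2 := norm_sub_sq_real u (gradient (truncValue M ρ π H) θ)
  rw [real_inner_comm] at h2
  have h3 : L * η * (η * ‖u‖ ^ 2) ≤ 1 / 2 * (η * ‖u‖ ^ 2) :=
    mul_le_mul_of_nonneg_right hηL (mul_nonneg hη (sq_nonneg _))
  rw [h2]
  linarith

/-- After `n + 1` iterations, `prev` is `θ_{n+1}`, `dir` is `u_{n+1}` and `cur` is `θ_{n+2}`; hence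
the error is measured against the gradient at `prev`. -/
theorem runMean_truncValue_ge (hρ : ρ ∈ stdSimplex ℝ S) {L : ℝ} {n : ℕ}
    (hη : 0 ≤ stepSize k m (n + 1)) (hηL : L * stepSize k m (n + 1) ≤ 1 / 2)
    (hL : ∀ θ v : Param d, truncValue M ρ π H θ + inner ℝ (gradient (truncValue M ρ π H) θ) v -
      L / 2 * ‖v‖ ^ 2 ≤ truncValue M ρ π H (θ + v)) :
    runMean M ρ π b k m c B θ₁ n (fun x => truncValue M ρ π H x.cur) +
        stepSize k m (n + 1) / 2 *
          runMean M ρ π b k m c B θ₁ n (fun x => ‖gradient (truncValue M ρ π H) x.cur‖ ^ 2) +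
        stepSize k m (n + 1) / 4 *
          runMean M ρ π b k m c B θ₁ (n + 1) (fun x => ‖x.dir‖ ^ 2) -
        stepSize k m (n + 1) / 2 *
          runMean M ρ π b k m c B θ₁ (n + 1)
            (fun x => ‖x.dir - gradient (truncValue M ρ π H) x.prev‖ ^ 2) ≤
      runMean M ρ π b k m c B θ₁ (n + 1) (fun x => truncValue M ρ π H x.cur) := by
  rw [← runMean_succ_prev hρ n (truncValue M ρ π H),
    ← runMean_succ_prev hρ n (fun θ => ‖gradient (truncValue M ρ π H) θ‖ ^ 2), sub_eq_add_neg,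
    ← neg_mul, ← runMean_const_mul, ← runMean_const_mul, ← runMean_const_mul, ← runMean_add,
    ← runMean_add, ← runMean_add]
  refine runMean_mono hρ fun ω _ => ?_
  have := truncValue_step_ge hη hηL hL (run M π b k m c θ₁ (n + 1) ω).prev
    (run M π b k m c θ₁ (n + 1) ω).dir
  rw [neg_mul, ← sub_eq_add_neg]
  exact this

theorem mean_norm_direction_one_sub_sq_le (hρ : ρ ∈ stdSimplex ℝ S) {Mg Mh : ℝ}
    (hπ : π.ScoreBounded Mg Mh) {G : ℝ} (hG : ∀ (θ : Param d) (τ : Traj S A H),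
      ‖gpomdp M π b θ τ‖ ≤ G) (hB : 1 ≤ B) (x : State d) :
    ∑ D : Fin B → Traj S A H, (∏ i, trajProb M ρ π x.cur (D i)) *
        ‖direction M π b k m c 1 x D - gradient (truncValue M ρ π H) x.cur‖ ^ 2 ≤ G ^ 2 / B := by
  have h1 := sum_prod_mul_norm_average_sq_le
    (sum_trajProb (M := M) (π := π) (H := H) hρ x.cur) (gpomdp M π b x.cur) 0 hB
  rw [sum_trajProb_smul_gpomdp hρ hπ] at h1
  simp only [zero_add, norm_zero, ne_eq, OfNat.ofNat_ne_zero, not_false_eq_true, zero_pow] at h1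
  simp only [direction, if_true]
  refine h1.trans ?_
  gcongr
  calc _ ≤ ∑ τ : Traj S A H, trajProb M ρ π x.cur τ * G ^ 2 := by
        refine Finset.sum_le_sum fun τ _ => ?_
        exact mul_le_mul_of_nonneg_left (pow_le_pow_left₀ (norm_nonneg _) (hG _ _) 2)
          (trajProb_nonneg hρ _ _)
    _ = _ := by rw [← Finset.sum_mul, sum_trajProb hρ, one_mul]

theorem norm_add_sq_le_two_mul {E : Type*} [SeminormedAddCommGroup E] (x y : E) :
    ‖x + y‖ ^ 2 ≤ 2 * ‖x‖ ^ 2 + 2 * ‖y‖ ^ 2 := by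
  have h1 := pow_le_pow_left₀ (norm_nonneg _) (norm_add_le x y) 2
  nlinarith [sq_nonneg (‖x‖ - ‖y‖)]

/-- The recursion for the mean square error of the momentum-based direction. -/
theorem mean_norm_direction_sub_sq_le (hρ : ρ ∈ stdSimplex ℝ S) {Mg Mh : ℝ}
    (hπ : π.ScoreBounded Mg Mh) {G Lg Q : ℝ} (hG : ∀ (θ : Param d) (τ : Traj S A H),
      ‖gpomdp M π b θ τ‖ ≤ G)
    (hLg : ∀ (θ θ' : Param d) (τ : Traj S A H),
      ‖gpomdp M π b θ τ - gpomdp M π b θ' τ‖ ≤ Lg * ‖θ - θ'‖) (hB : 1 ≤ B) {t : ℕ} (ht : t ≠ 1)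
    (hβ0 : 0 ≤ momentum k m c t) (hβ1 : momentum k m c t ≤ 1) (x : State d)
    (hQ : trajVar M ρ π x.cur (isWeight (H := H) π x.prev x.cur) ≤
      Q * ‖x.prev - x.cur‖ ^ 2) :
    ∑ D : Fin B → Traj S A H, (∏ i, trajProb M ρ π x.cur (D i)) *
        ‖direction M π b k m c t x D - gradient (truncValue M ρ π H) x.cur‖ ^ 2 ≤
      (1 - momentum k m c t) ^ 2 * ‖x.dir - gradient (truncValue M ρ π H) x.prev‖ ^ 2 +
        (2 * momentum k m c t ^ 2 * G ^ 2 +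
          4 * (Lg ^ 2 + G ^ 2 * Q) * ‖x.cur - x.prev‖ ^ 2) / B := by
  set β := momentum k m c t with hβ
  set g := gpomdp M π b x.cur with hg
  set g' := gpomdp M π b x.prev with hg'
  set w := isWeight (H := H) π x.prev x.cur with hw
  set p := trajProb M ρ π (H := H) x.cur with hpdef
  have hp : ∑ τ, p τ = 1 := sum_trajProb hρ x.cur
  have hp0 : ∀ τ, 0 ≤ p τ := trajProb_nonneg hρ x.cur
  -- `Y` collects all the fresh randomness of one trajectory. Reweighting makes `w g'` unbiased for
  -- the gradient at `x.prev`, so the error of the direction is `(1 - β)` times the old error plus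
  -- the centred batch average of `Y`.
  set Y : Traj S A H → Param d := fun τ => g τ - (1 - β) • (w τ • g' τ) with hY
  have hmean : ∑ τ, p τ • Y τ = gradient (truncValue M ρ π H) x.cur -
      (1 - β) • gradient (truncValue M ρ π H) x.prev := by
    rw [← sum_trajProb_smul_gpomdp hρ hπ b x.cur, ← sum_trajProb_smul_gpomdp hρ hπ b x.prev,
      Finset.smul_sum, ← Finset.sum_sub_distrib]
    refine Finset.sum_congr rfl fun τ _ => ?_
    rw [← trajProb_mul_isWeight M ρ π x.prev x.cur]
    simp only [hY, hpdef, hg, hg', hw]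
    module
  have h1 := sum_prod_mul_norm_average_sq_le hp Y
    ((1 - β) • (x.dir - gradient (truncValue M ρ π H) x.prev)) hB
  rw [hmean, norm_smul, mul_pow, Real.norm_eq_abs, sq_abs] at h1
  have h2 : ∀ D : Fin B → Traj S A H,
      (1 - β) • (x.dir - gradient (truncValue M ρ π H) x.prev) + (1 / (B : ℝ)) • ∑ j, Y (D j) -
        (gradient (truncValue M ρ π H) x.cur -
          (1 - β) • gradient (truncValue M ρ π H) x.prev) =
      direction M π b k m c t x D - gradient (truncValue M ρ π H) x.cur := by
    intro D
    simp only [direction, if_neg ht, hY, Finset.sum_sub_distrib, ← Finset.smul_sum, ← hβ, ← hg,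
      ← hg', ← hw]
    module
  simp_rw [h2] at h1
  refine h1.trans ?_
  have h3 : ∀ τ, ‖Y τ‖ ^ 2 ≤ 2 * β ^ 2 * G ^ 2 + 4 * Lg ^ 2 * ‖x.cur - x.prev‖ ^ 2 +
      4 * G ^ 2 * (w τ - 1) ^ 2 := by
    intro τ
    -- This splitting isolates the three sources of noise: fresh sampling, of size `β`; the change
    -- of the estimator; and the deviation of the weight from `1`.
    have e1 : Y τ = β • g τ + (1 - β) • ((g τ - g' τ) + (1 - w τ) • g' τ) := by
      simp only [hY]
      module
    have i1 := norm_add_sq_le_two_mul (β • g τ) ((1 - β) • ((g τ - g' τ) + (1 - w τ) • g' τ))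
    have i2 := norm_add_sq_le_two_mul (g τ - g' τ) ((1 - w τ) • g' τ)
    rw [← e1] at i1
    simp only [norm_smul, mul_pow, Real.norm_eq_abs, sq_abs] at i1 i2
    have i3 : ‖g τ‖ ^ 2 ≤ G ^ 2 := pow_le_pow_left₀ (norm_nonneg _) (hG _ _) 2
    have i4 : ‖g' τ‖ ^ 2 ≤ G ^ 2 := pow_le_pow_left₀ (norm_nonneg _) (hG _ _) 2
    have i5 := pow_le_pow_left₀ (norm_nonneg _) (hLg x.cur x.prev τ) 2
    rw [mul_pow] at i5
    have i6 : (1 - β) ^ 2 ≤ 1 := pow_le_one₀ (by linarith) (by linarith)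
    have i7 : (1 - β) ^ 2 * ‖(g τ - g' τ) + (1 - w τ) • g' τ‖ ^ 2 ≤
        ‖(g τ - g' τ) + (1 - w τ) • g' τ‖ ^ 2 :=
      mul_le_of_le_one_left (sq_nonneg _) i6
    have i8 := mul_le_mul_of_nonneg_left i3 (sq_nonneg β)
    have i9 := mul_le_mul_of_nonneg_left i4 (sq_nonneg (1 - w τ))
    linarith
  have h4 : ∑ τ, p τ * (w τ - 1) ^ 2 ≤ Q * ‖x.cur - x.prev‖ ^ 2 := by
    rw [trajVar, trajMean_isWeight hρ, norm_sub_rev] at hQ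
    exact hQ
  have h5 : ∑ τ, p τ * ‖Y τ‖ ^ 2 ≤ 2 * β ^ 2 * G ^ 2 +
      4 * (Lg ^ 2 + G ^ 2 * Q) * ‖x.cur - x.prev‖ ^ 2 := by
    calc _ ≤ ∑ τ, (p τ * (2 * β ^ 2 * G ^ 2 + 4 * Lg ^ 2 * ‖x.cur - x.prev‖ ^ 2) +
          4 * G ^ 2 * (p τ * (w τ - 1) ^ 2)) := by
          refine Finset.sum_le_sum fun τ _ => (mul_le_mul_of_nonneg_left (h3 τ) (hp0 τ)).trans ?_
          exact le_of_eq (by ring)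
      _ = 2 * β ^ 2 * G ^ 2 + 4 * Lg ^ 2 * ‖x.cur - x.prev‖ ^ 2 +
          4 * G ^ 2 * ∑ τ, p τ * (w τ - 1) ^ 2 := by
          rw [Finset.sum_add_distrib, ← Finset.sum_mul, hp, one_mul, ← Finset.mul_sum]
      _ ≤ 2 * β ^ 2 * G ^ 2 + 4 * Lg ^ 2 * ‖x.cur - x.prev‖ ^ 2 +
          4 * G ^ 2 * (Q * ‖x.cur - x.prev‖ ^ 2) := by
          gcongr
      _ = _ := by ring
  gcongr

theorem runMean_error_one_le (hρ : ρ ∈ stdSimplex ℝ S) {Mg Mh : ℝ}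
    (hπ : π.ScoreBounded Mg Mh) {G : ℝ} (hG : ∀ (θ : Param d) (τ : Traj S A H),
      ‖gpomdp M π b θ τ‖ ≤ G) (hB : 1 ≤ B) :
    runMean M ρ π b k m c B θ₁ 1
      (fun x => ‖x.dir - gradient (truncValue M ρ π H) x.prev‖ ^ 2) ≤ G ^ 2 / B := by
  rw [runMean_succ, runMean_zero]
  exact mean_norm_direction_one_sub_sq_le (k := k) (m := m) (c := c) hρ hπ hG hB _

theorem runMean_error_succ_le (hρ : ρ ∈ stdSimplex ℝ S) {Mg Mh : ℝ}
    (hπ : π.ScoreBounded Mg Mh) {G Lg Q : ℝ} (hG : ∀ (θ : Param d) (τ : Traj S A H),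
      ‖gpomdp M π b θ τ‖ ≤ G)
    (hLg : ∀ (θ θ' : Param d) (τ : Traj S A H),
      ‖gpomdp M π b θ τ - gpomdp M π b θ' τ‖ ≤ Lg * ‖θ - θ'‖) (hB : 1 ≤ B) {n : ℕ}
    (hβ0 : 0 ≤ c * stepSize k m (n + 1) ^ 2) (hβ1 : c * stepSize k m (n + 1) ^ 2 ≤ 1)
    (hQ : ∀ ω : Fin (n + 1) → Fin B → Traj S A H, 0 < runProb M ρ π b k m c θ₁ (n + 1) ω →
      trajVar M ρ π (run M π b k m c θ₁ (n + 1) ω).cur (isWeight (H := H) π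
        (run M π b k m c θ₁ (n + 1) ω).prev (run M π b k m c θ₁ (n + 1) ω).cur) ≤
      Q * ‖(run M π b k m c θ₁ (n + 1) ω).prev - (run M π b k m c θ₁ (n + 1) ω).cur‖ ^ 2) :
    runMean M ρ π b k m c B θ₁ (n + 2)
        (fun x => ‖x.dir - gradient (truncValue M ρ π H) x.prev‖ ^ 2) ≤
      (1 - c * stepSize k m (n + 1) ^ 2) ^ 2 * runMean M ρ π b k m c B θ₁ (n + 1)
        (fun x => ‖x.dir - gradient (truncValue M ρ π H) x.prev‖ ^ 2) +
      (2 * (c * stepSize k m (n + 1) ^ 2) ^ 2 * G ^ 2 +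
        4 * (Lg ^ 2 + G ^ 2 * Q) * stepSize k m (n + 1) ^ 2 *
          runMean M ρ π b k m c B θ₁ (n + 1) (fun x => ‖x.dir‖ ^ 2)) / B := by
  rw [runMean_succ]
  calc _ ≤ runMean M ρ π b k m c B θ₁ (n + 1) (fun x =>
        (1 - c * stepSize k m (n + 1) ^ 2) ^ 2 *
          ‖x.dir - gradient (truncValue M ρ π H) x.prev‖ ^ 2 +
        (2 * (c * stepSize k m (n + 1) ^ 2) ^ 2 * G ^ 2 / B +
          4 * (Lg ^ 2 + G ^ 2 * Q) * stepSize k m (n + 1) ^ 2 / B * ‖x.dir‖ ^ 2)) := by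
        refine runMean_mono hρ fun ω hω => ?_
        refine (mean_norm_direction_sub_sq_le hρ hπ hG hLg hB (t := n + 1 + 1) (by omega) hβ0 hβ1 _
          (hQ ω hω)).trans (le_of_eq ?_)
        -- The displacement is `η_{n+1} u_{n+1}`, which turns the squared distance into `‖dir‖²`;
        -- likewise `β_{n+2}` involves `η_{n+1}`.
        have h1 : (run M π b k m c θ₁ (n + 1) ω).cur - (run M π b k m c θ₁ (n + 1) ω).prev =
            stepSize k m (n + 1) • (run M π b k m c θ₁ (n + 1) ω).dir := by
          simp [run, step]
        rw [h1, norm_smul, mul_pow, Real.norm_eq_abs, sq_abs]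
        simp only [momentum, Nat.add_sub_cancel]
        ring
    _ = _ := by
        rw [runMean_add, runMean_add, runMean_const hρ, runMean_const_mul, runMean_const_mul]
        ring

end Run

/-! ### The potential argument -/

/-- In the application `a n` and `q n` are the means of `J` and `‖∇J‖²` at `θ_{n+1}`, while `U n`
and `V n` are the mean squares of `u_n` and of its error. The descent inequality, multiplied by `192
bb`, is added to the recursion for `V (n+1) / η n`. -/
theorem sum_mul_le_of_descent {η a q U V : ℕ → ℝ} {c G bb B : ℝ} {N : ℕ}
    (hη : ∀ n, 0 < η n) (hanti : ∀ n, η (n + 1) ≤ η n) (hbb : 0 < bb) (hc : 96 * bb ≤ c)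
    (hcη : ∀ n, c * η n ^ 2 ≤ 1)
    (hdiff : ∀ n, 1 / η (n + 1) - 1 / η n ≤ (c - 96 * bb) * η (n + 1)) (hB : 1 ≤ B)
    (hU : ∀ n, 0 ≤ U n) (hV : ∀ n, 0 ≤ V n)
    (hdesc : ∀ n, a n + η (n + 1) / 2 * q n + η (n + 1) / 4 * U (n + 1) -
      η (n + 1) / 2 * V (n + 1) ≤ a (n + 1))
    (hV1 : V 1 ≤ G ^ 2 / B)
    (hVs : ∀ n < N, V (n + 2) ≤ (1 - c * η (n + 1) ^ 2) ^ 2 * V (n + 1) +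
      (2 * (c * η (n + 1) ^ 2) ^ 2 * G ^ 2 + 4 * bb * η (n + 1) ^ 2 * U (n + 1)) / B) :
    ∑ n ∈ Finset.range (N + 1), η (n + 1) * q n ≤
      2 * (a (N + 1) - a 0) + 1 / (96 * bb) *
        (G ^ 2 / (B * η 0) + 2 * c ^ 2 * G ^ 2 / B * ∑ n ∈ Finset.range N, η (n + 1) ^ 3) := by
  have hB0 : 0 < B := by linarith
  have step : ∀ n < N, V (n + 2) / η (n + 1) ≤ V (n + 1) / η n - 96 * bb * η (n + 1) * V (n + 1) +
      48 * bb * η (n + 1) * U (n + 1) + 2 * c ^ 2 * G ^ 2 / B * η (n + 1) ^ 3 := by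
    intro n hn
    have he := hη (n + 1)
    set e := η (n + 1) with hedef
    have hce := hcη (n + 1)
    have hce0 : 0 ≤ c * e ^ 2 := mul_nonneg (by linarith) (sq_nonneg e)
    -- One factor `1 - c e²` is discarded. The other yields `-c e`, of which `c - 96 bb` offsets the
    -- growth of `1/η` and `96 bb` is kept to cancel the error term of the descent.
    have h1 : (1 - c * e ^ 2) ^ 2 / e ≤ 1 / η n - 96 * bb * e := by
      calc _ ≤ (1 - c * e ^ 2) / e := by
            gcongr
            rw [pow_two]
            exact mul_le_of_le_one_left (by linarith) (by linarith)
        _ = 1 / e - c * e := by field_simp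
        _ ≤ _ := by linarith [hdiff n]
    have h2 : bb * e * U (n + 1) / B ≤ bb * e * U (n + 1) :=
      div_le_self (mul_nonneg (mul_pos hbb he).le (hU _)) hB
    have h3 := mul_le_mul_of_nonneg_right h1 (hV (n + 1))
    have h4 : 0 ≤ bb * e * U (n + 1) := mul_nonneg (mul_pos hbb he).le (hU _)
    calc V (n + 2) / e ≤ ((1 - c * e ^ 2) ^ 2 * V (n + 1) +
          (2 * (c * e ^ 2) ^ 2 * G ^ 2 + 4 * bb * e ^ 2 * U (n + 1)) / B) / e := by
          gcongr
          exact hVs n hn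
      _ = (1 - c * e ^ 2) ^ 2 / e * V (n + 1) + 2 * c ^ 2 * G ^ 2 / B * e ^ 3 +
          4 * (bb * e * U (n + 1) / B) := by
          field_simp
          ring
      _ ≤ (1 / η n - 96 * bb * e) * V (n + 1) + 2 * c ^ 2 * G ^ 2 / B * e ^ 3 +
          48 * (bb * e * U (n + 1)) := by linarith
      _ = _ := by ring
  -- The descent runs one index ahead of the recursion: its last `V` and `U` terms stay on the left
  -- and are exactly what the next use of `step` consumes.
  have main : ∀ j ≤ N, 96 * bb * (∑ n ∈ Finset.range (j + 1), η (n + 1) * q n) +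
      V (j + 1) / η j - 96 * bb * η (j + 1) * V (j + 1) + 48 * bb * η (j + 1) * U (j + 1) ≤
      192 * bb * (a (j + 1) - a 0) + (G ^ 2 / (B * η 0) +
        2 * c ^ 2 * G ^ 2 / B * ∑ n ∈ Finset.range j, η (n + 1) ^ 3) := by
    intro j
    induction j with
    | zero =>
      intro _
      have h1 := mul_le_mul_of_nonneg_left (hdesc 0) hbb.le
      have h2 : V 1 / η 0 ≤ G ^ 2 / (B * η 0) := by
        rw [← div_div]
        exact div_le_div_of_nonneg_right hV1 (hη 0).le
      simp only [zero_add, Finset.sum_range_one, Finset.range_zero, Finset.sum_empty, mul_zero,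
        add_zero] at h1 ⊢
      linarith
    | succ j ih =>
      intro hj
      have h1 := mul_le_mul_of_nonneg_left (hdesc (j + 1)) hbb.le
      have h2 := step j (by omega)
      have h3 := ih (by omega)
      rw [Finset.sum_range_succ _ (j + 1), Finset.sum_range_succ (fun n => η (n + 1) ^ 3) j,
        mul_add (96 * bb), mul_add (2 * c ^ 2 * G ^ 2 / B)]
      linarith
  have h1 := main N le_rfl
  -- After the last descent no recursion follows; the remaining potential itself pays for the
  -- leftover error.
  have h2 : 96 * bb * η (N + 1) * V (N + 1) ≤ V (N + 1) / η N := by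
    rw [le_div_iff₀ (hη N)]
    have h3 : 96 * bb * η (N + 1) * η N ≤ 1 := by
      calc 96 * bb * η (N + 1) * η N ≤ c * η N * η N := by
            have : 0 ≤ c := by linarith
            have := hη N
            have := hη (N + 1)
            have := hanti N
            gcongr
        _ = c * η N ^ 2 := by ring
        _ ≤ 1 := hcη N
    have := mul_le_mul_of_nonneg_right h3 (hV (N + 1))
    linarith
  have h3 : 0 ≤ bb * η (N + 1) * U (N + 1) := mul_nonneg (mul_pos hbb (hη _)).le (hU _)
  have h4 : (∑ n ∈ Finset.range (N + 1), η (n + 1) * q n) * (96 * bb) ≤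
      192 * bb * (a (N + 1) - a 0) + (G ^ 2 / (B * η 0) +
        2 * c ^ 2 * G ^ 2 / B * ∑ n ∈ Finset.range N, η (n + 1) ^ 3) := by linarith
  rw [← le_div_iff₀ (by positivity)] at h4
  refine h4.trans (le_of_eq ?_)
  field_simp
  ring

/-! ### The step sizes -/

theorem rpow_third_pow_three {x : ℝ} (hx : 0 ≤ x) : (x ^ (1 / 3 : ℝ)) ^ 3 = x := by
  rw [← Real.rpow_natCast, ← Real.rpow_mul hx]
  norm_num

section StepSize

variable {k m : ℝ}

theorem stepSize_pos (hk : 0 < k) (hm : 2 ≤ m) (t : ℕ) : 0 < stepSize k m t :=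
  div_pos hk (Real.rpow_pos_of_pos (by positivity) _)

theorem stepSize_antitone (hk : 0 < k) (hm : 2 ≤ m) : Antitone (stepSize k m) := by
  intro s t hst
  have : (s : ℝ) ≤ t := by exact_mod_cast hst
  have h : 0 < m + (s : ℝ) := by positivity
  rw [stepSize, stepSize]
  gcongr

theorem stepSize_pow_three (hm : 2 ≤ m) (t : ℕ) : stepSize k m t ^ 3 = k ^ 3 / (m + t) := by
  rw [stepSize, div_pow, rpow_third_pow_three (by positivity)]

theorem mul_stepSize_le {a r : ℝ} (hm : 2 ≤ m) (hr : 0 < r)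
    (ham : (a * k / r) ^ 3 ≤ m) (t : ℕ) : a * stepSize k m t ≤ r := by
  have hy : 0 < (m + t) ^ (1 / 3 : ℝ) := Real.rpow_pos_of_pos (by positivity) _
  have h1 : a * k / r ≤ (m + t) ^ (1 / 3 : ℝ) := by
    by_contra! h
    have h2 := pow_lt_pow_left₀ h hy.le three_ne_zero
    rw [rpow_third_pow_three (by positivity)] at h2
    linarith [Nat.cast_nonneg (α := ℝ) t]
  rw [stepSize, ← mul_div_assoc, div_le_iff₀ hy]
  rw [div_le_iff₀ hr] at h1
  linarith

/-- For the consecutive cube roots `x` and `y` one has `y - x = 1/(y² + xy + x²)`, of order `y⁻²`;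
one factor `y` is traded for `2 L k ≤ y`. This is where the summand `1/(3 k³ L)` of `c` comes from.
-/
theorem one_div_stepSize_sub_le {L : ℝ} (hk : 0 < k) (hm : 2 ≤ m) (hL : 0 < L)
    (hLη : ∀ t, 2 * L * stepSize k m t ≤ 1) (t : ℕ) :
    1 / stepSize k m (t + 1) - 1 / stepSize k m t ≤
      1 / (3 * k ^ 3 * L) * stepSize k m (t + 1) := by
  have h1 := hLη (t + 1)
  set x := (m + t) ^ (1 / 3 : ℝ) with hx
  set y := (m + (t + 1 : ℕ)) ^ (1 / 3 : ℝ) with hy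
  have hx0 : 0 < x := Real.rpow_pos_of_pos (by positivity) _
  have hy0 : 0 < y := Real.rpow_pos_of_pos (by positivity) _
  have hx3 : x ^ 3 = m + t := rpow_third_pow_three (by positivity)
  have hy3 : y ^ 3 = x ^ 3 + 1 := by
    rw [hx3, hy, rpow_third_pow_three (by positivity)]
    push_cast
    ring
  -- Any ratio that gives `y² ≤ 2xy + 2x²` would do; `5/4` follows from `x³ ≥ 2`.
  have hyx : y ≤ 5 / 4 * x := by
    by_contra! h
    have h2 := pow_lt_pow_left₀ h (by positivity) three_ne_zero
    have : 2 ≤ x ^ 3 := by rw [hx3]; linarith [Nat.cast_nonneg (α := ℝ) t]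
    rw [hy3, mul_pow] at h2
    linarith
  have e1 : stepSize k m t = k / x := rfl
  have e2 : stepSize k m (t + 1) = k / y := rfl
  rw [e2] at h1
  rw [e1, e2]
  have h2 : 2 * L * k ≤ y := by
    rw [← mul_div_assoc, div_le_one hy0] at h1
    exact h1
  have h3 : 3 * ((y - x) * y ^ 2) ≤ 2 := by
    have : (y - x) * (y ^ 2 + x * y + x ^ 2) = 1 := by linear_combination hy3
    have hyx' : x ≤ y := by
      by_contra! h
      have := pow_lt_pow_left₀ h hy0.le three_ne_zero
      linarith
    have h5 : y ^ 2 ≤ 2 / 3 * (y ^ 2 + x * y + x ^ 2) := by nlinarith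
    have := mul_le_mul_of_nonneg_left h5 (sub_nonneg.2 hyx')
    linarith
  have e3 : 1 / (k / y) - 1 / (k / x) = (y - x) / k := by field_simp
  have e4 : 1 / (3 * k ^ 3 * L) * (k / y) = 1 / (3 * k ^ 2 * L * y) := by field_simp
  rw [e3, e4, div_le_div_iff₀ hk (by positivity)]
  have h6 : (y - x) * y * (2 * L * k) ≤ (y - x) * y * y := by
    have hyx' : x ≤ y := by
      by_contra! h
      have := pow_lt_pow_left₀ h hy0.le three_ne_zero
      linarith
    exact mul_le_mul_of_nonneg_left h2 (mul_nonneg (sub_nonneg.2 hyx') hy0.le)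
  have h7 : 3 * ((y - x) * y * (2 * L * k)) * k ≤ 2 * k := by
    refine mul_le_mul_of_nonneg_right ?_ hk.le
    linarith
  linarith

/-- The exponent `1/3` makes `η³` harmonic, and `m ≥ 2` bounds the terms by increments of `log`. -/
theorem sum_stepSize_pow_three_le (hk : 0 < k) (hm : 2 ≤ m) (N : ℕ) :
    ∑ n ∈ Finset.range N, stepSize k m (n + 1) ^ 3 ≤ k ^ 3 * Real.log (N + 2) := by
  induction N with
  | zero =>
    simp only [Finset.range_zero, Finset.sum_empty, CharP.cast_eq_zero, zero_add]
    have := Real.log_nonneg (one_le_two (α := ℝ))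
    positivity
  | succ N ih =>
    rw [Finset.sum_range_succ]
    have h1 : stepSize k m (N + 1) ^ 3 ≤ k ^ 3 * (1 / ((N : ℝ) + 3)) := by
      rw [stepSize_pow_three hm, div_eq_mul_one_div]
      have : (N : ℝ) + 3 ≤ m + (N + 1 : ℕ) := by
        push_cast
        linarith
      gcongr
    have h2 : 1 / ((N : ℝ) + 3) ≤ Real.log ((N + 1 : ℕ) + 2) - Real.log (N + 2) := by
      have h3 := Real.one_sub_inv_le_log_of_pos (x := ((N : ℝ) + 3) / (N + 2)) (by positivity)
      rw [Real.log_div (by positivity) (by positivity)] at h3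
      have e1 : 1 - (((N : ℝ) + 3) / (N + 2))⁻¹ = 1 / ((N : ℝ) + 3) := by
        field_simp
        ring
      have e2 : ((N + 1 : ℕ) : ℝ) + 2 = N + 3 := by
        push_cast
        ring
      rw [e2]
      linarith
    have h4 := mul_le_mul_of_nonneg_left h2 (pow_pos hk 3).le
    linarith

end StepSize

/-! ### The constants -/

namespace Consts

variable {K : Consts}

theorem L_pos (hγ : K.γ ∈ Set.Ioo (0 : ℝ) 1) (hMg : 0 < K.Mg) (hMh : 0 < K.Mh) : 0 < K.L := by
  have : 0 < 1 - K.γ := by linarith [hγ.2]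
  unfold L
  positivity

theorem bSq_pos (hγ : K.γ ∈ Set.Ioo (0 : ℝ) 1) (hMh : 0 < K.Mh) : 0 < K.bSq := by
  have : 0 < 1 - K.γ := by linarith [hγ.2]
  unfold bSq Lg
  positivity

theorem two_le_m : 2 ≤ K.m := le_max_left _ _

theorem sq_Cw (hMh : 0 < K.Mh) (hW : 0 < K.W) :
    K.Cw ^ 2 = K.H * (2 * K.H * K.Mg ^ 2 + K.Mh) * (K.W + 1) :=
  Real.sq_sqrt (by positivity)

/-- The part of `Γ₁` and `Γ₃` that multiplies the logarithm, when all terms are put there. -/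
noncomputable def logCoeff (K : Consts) : ℝ :=
  K.c ^ 2 * K.σ ^ 2 * K.k ^ 3 / (48 * K.bSq) + K.m ^ (1 / 3 : ℝ) / (96 * K.bSq * K.k) * K.σ ^ 2 +
    1 / (22 * (1 - K.γ)) + K.σ ^ 2 * K.m ^ (1 / 3 : ℝ) / (44 * K.bSq * K.k ^ 2) +
    K.c ^ 2 * K.σ ^ 2 * K.k ^ 3 / (22 * K.k * K.bSq)

theorem one_le_log {T : ℕ} (hT : 1 ≤ T) : 1 ≤ Real.log (T + 2) := by
  have h1 : (1 : ℝ) ≤ T := by exact_mod_cast hT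
  rw [Real.le_log_iff_exp_le (by positivity)]
  linarith [Real.exp_one_lt_three]

theorem Γ₁_add_Γ₃_le (hγ : K.γ ∈ Set.Ioo (0 : ℝ) 1) (hMh : 0 < K.Mh) (hk : 0 < K.k) {T : ℕ}
    (hT : 1 ≤ T) : K.Γ₁ T + K.Γ₃ T ≤ K.logCoeff * Real.log (T + 2) := by
  have h1 : 0 < 1 - K.γ := by linarith [hγ.2]
  have h2 := bSq_pos hγ hMh
  have h3 := one_le_log hT
  have h4 : 0 < K.m ^ (1 / 3 : ℝ) := Real.rpow_pos_of_pos (by linarith [K.two_le_m]) _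
  have a1 := le_mul_of_one_le_right
    (show 0 ≤ K.m ^ (1 / 3 : ℝ) / (96 * K.bSq * K.k) * K.σ ^ 2 by positivity) h3
  have a2 := le_mul_of_one_le_right (show 0 ≤ 1 / (22 * (1 - K.γ)) by positivity) h3
  have a3 := le_mul_of_one_le_right
    (show 0 ≤ K.σ ^ 2 * K.m ^ (1 / 3 : ℝ) / (44 * K.bSq * K.k ^ 2) by positivity) h3
  rw [Γ₁, Γ₃, logCoeff, add_comm (2 : ℝ), mul_div_right_comm]
  linarith

theorem Γ₂_pos (hγ : K.γ ∈ Set.Ioo (0 : ℝ) 1) : 0 < K.Γ₂ := by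
  have : 0 < 1 - K.γ := by linarith [hγ.2]
  unfold Γ₂
  positivity

theorem Γ₁_nonneg (hγ : K.γ ∈ Set.Ioo (0 : ℝ) 1) (hMh : 0 < K.Mh) (hk : 0 < K.k) (T : ℕ) :
    0 ≤ K.Γ₁ T := by
  have h1 : 0 < 1 - K.γ := by linarith [hγ.2]
  have h2 := bSq_pos hγ hMh
  have h3 : 0 ≤ Real.log (T + 2) := Real.log_nonneg (by linarith [Nat.cast_nonneg (α := ℝ) T])
  have h4 : 0 < K.m ^ (1 / 3 : ℝ) := Real.rpow_pos_of_pos (by linarith [K.two_le_m]) _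
  unfold Γ₁
  positivity

theorem Γ₃_nonneg (hγ : K.γ ∈ Set.Ioo (0 : ℝ) 1) (hMh : 0 < K.Mh) (hk : 0 < K.k) (T : ℕ) :
    0 ≤ K.Γ₃ T := by
  have h2 := bSq_pos hγ hMh
  have h3 : 0 ≤ Real.log (2 + T) := Real.log_nonneg (by linarith [Nat.cast_nonneg (α := ℝ) T])
  have h4 : 0 < K.m ^ (1 / 3 : ℝ) := Real.rpow_pos_of_pos (by linarith [K.two_le_m]) _
  unfold Γ₃
  positivity

end Consts

/-! ### The rate -/

theorem rpow_sixth_sq {x : ℝ} (hx : 0 ≤ x) : (x ^ (1 / 6 : ℝ)) ^ 2 = x ^ (1 / 3 : ℝ) := by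
  rw [← Real.rpow_natCast, ← Real.rpow_mul hx]
  norm_num

/-- From a bound on the weighted sum of the squares to a bound on the average. -/
theorem average_le_of_sum_stepSize_mul_le {k m X : ℝ} {e q : ℕ → ℝ} {T : ℕ} (hk : 0 < k)
    (hm : 2 ≤ m) (hT : 1 ≤ T) (hX : 0 ≤ X) (heq : ∀ n, e n ^ 2 ≤ q n)
    (h : ∑ n ∈ Finset.range T, stepSize k m (n + 1) * q n ≤ X) :
    (1 / (T : ℝ)) * ∑ n ∈ Finset.range T, e n ≤
      Real.sqrt (X / k) * (m ^ (1 / 6 : ℝ) / Real.sqrt T + 1 / (T : ℝ) ^ (1 / 3 : ℝ)) := by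
  have hT0 : (0 : ℝ) < T := by exact_mod_cast hT
  have hm0 : 0 ≤ m := by linarith
  have h1 : stepSize k m T * ∑ n ∈ Finset.range T, q n ≤ X := by
    refine le_trans ?_ h
    rw [Finset.mul_sum]
    refine Finset.sum_le_sum fun n hn => mul_le_mul_of_nonneg_right ?_
      ((sq_nonneg _).trans (heq n))
    exact stepSize_antitone hk hm (by have := Finset.mem_range.1 hn; omega)
  have h2 : ((1 / (T : ℝ)) * ∑ n ∈ Finset.range T, e n) ^ 2 ≤
      1 / (T : ℝ) * ∑ n ∈ Finset.range T, q n := by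
    have := (sq_sum_le_card_mul_sum_sq (s := Finset.range T) (f := e)).trans
      (mul_le_mul_of_nonneg_left (Finset.sum_le_sum fun n _ => heq n) (Nat.cast_nonneg _))
    rw [Finset.card_range] at this
    calc _ = (1 / (T : ℝ)) ^ 2 * (∑ n ∈ Finset.range T, e n) ^ 2 := by ring
      _ ≤ (1 / (T : ℝ)) ^ 2 * (T * ∑ n ∈ Finset.range T, q n) := by gcongr
      _ = _ := by field_simp
  -- Subadditivity of the cube root gives `y ≤ m^{1/3} + T^{1/3}`. Written with sixth roots this is
  -- at most `(p + r)²`, so taking the square root of the bound produces the two summands.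
  set y := (m + T) ^ (1 / 3 : ℝ) with hy
  have hy0 : 0 < y := Real.rpow_pos_of_pos (by positivity) _
  have h3 : ∑ n ∈ Finset.range T, q n ≤ X / k * y := by
    have e1 : stepSize k m T = k / y := rfl
    rw [e1, div_mul_eq_mul_div, div_le_iff₀ hy0, ← le_div_iff₀' hk] at h1
    rwa [div_mul_eq_mul_div]
  set p := m ^ (1 / 6 : ℝ) with hp
  set r := (T : ℝ) ^ (1 / 6 : ℝ) with hr
  have hp0 : 0 ≤ p := Real.rpow_nonneg hm0 _
  have hr0 : 0 < r := Real.rpow_pos_of_pos hT0 _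
  have h4 : y ≤ (p + r) ^ 2 := by
    have := Real.rpow_add_le_add_rpow (p := 1 / 3) hm0 hT0.le (by norm_num) (by norm_num)
    rw [← rpow_sixth_sq hm0, ← rpow_sixth_sq hT0.le, ← hp, ← hr] at this
    nlinarith [mul_nonneg hp0 hr0.le]
  have e2 : Real.sqrt T = r ^ 3 := by
    rw [Real.sqrt_eq_rpow, hr, ← Real.rpow_natCast, ← Real.rpow_mul hT0.le]
    norm_num
  have e3 : (T : ℝ) ^ (1 / 3 : ℝ) = r ^ 2 := (rpow_sixth_sq hT0.le).symm
  have e4 : (T : ℝ) = r ^ 6 := by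
    rw [hr, ← Real.rpow_natCast, ← Real.rpow_mul hT0.le]
    norm_num
  have hXk : 0 ≤ X / k := div_nonneg hX hk.le
  rw [e2, e3]
  refine le_of_sq_le_sq ?_ (by positivity)
  rw [mul_pow (√(X / k)), Real.sq_sqrt hXk]
  calc _ ≤ _ := h2
    _ ≤ 1 / (T : ℝ) * (X / k * (p + r) ^ 2) := by gcongr; exact h3.trans (by gcongr)
    _ = X / k * (p / r ^ 3 + 1 / r ^ 2) ^ 2 := by
      rw [e4]
      field_simp

namespace Consts

variable {K : Consts}

theorem two_L_mul_stepSize_le (t : ℕ) : 2 * K.L * stepSize K.k K.m t ≤ 1 := by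
  refine mul_stepSize_le two_le_m one_pos ?_ t
  rw [div_one]
  exact (le_max_left _ _).trans (le_max_right _ _)

/-- The last two entries of the maximum `m` give `2 L η ≤ 1` and `c η ≤ 2 L`; together they keep the
momentum parameters at most `1`. -/
theorem c_mul_stepSize_sq_le (hL : 0 < K.L) (hk : 0 < K.k) (t : ℕ) :
    K.c * stepSize K.k K.m t ^ 2 ≤ 1 := by
  have h1 : K.c * stepSize K.k K.m t ≤ 2 * K.L :=
    mul_stepSize_le two_le_m (by linarith) ((le_max_right _ _).trans (le_max_right _ _)) t
  have h2 := mul_le_mul_of_nonneg_right h1 (stepSize_pos hk (two_le_m (K := K)) t).le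
  linarith [two_L_mul_stepSize_le (K := K) t]

end Consts

/-! ### Assembly: the weighted sum of mean squared gradient norms. -/

section Main

theorem meanGradNorm_eq {S A : Type*} [Fintype S] [Fintype A] {d : ℕ} (M : MDP S A) (ρ : S → ℝ)
    (π : PolicyClass S A d) {H : ℕ} (b : Fin H → ℝ) (k m c : ℝ) (B : ℕ) (θ₁ : Param d) (n : ℕ) :
    meanGradNorm M ρ π b k m c B θ₁ n =
      runMean M ρ π b k m c B θ₁ n (fun x => ‖gradient (truncValue M ρ π H) x.cur‖) := rfl

variable {S A : Type*} [Fintype S] [Fintype A] {d : ℕ} {K : Consts}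
  {M : MDP S A} {ρ : S → ℝ} {π : PolicyClass S A d} {b : Fin K.H → ℝ} {θ₁ : Param d} {B T : ℕ}

theorem sum_stepSize_mul_mean_sq_le (hγ : K.γ ∈ Set.Ioo (0 : ℝ) 1) (hMg : 0 < K.Mg)
    (hMh : 0 < K.Mh) (hW : 0 < K.W) (hk : 0 < K.k) (hMγ : M.γ = K.γ) (hρ : ρ ∈ stdSimplex ℝ S)
    (hπ : π.ScoreBounded K.Mg K.Mh)
    (hb : ∀ (h : Fin K.H) (s : S) (a : A),
      |M.γ ^ (h : ℕ) * M.r s a - b h| ≤ M.γ ^ (h : ℕ))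
    (hB : 1 ≤ B) (hT : 1 ≤ T) (hvar : WeightVarianceBounded M ρ π b K.k K.m K.c B θ₁ T K.W) :
    ∑ n ∈ Finset.range T, stepSize K.k K.m (n + 1) *
        runMean M ρ π b K.k K.m K.c B θ₁ n
          (fun x => ‖gradient (truncValue M ρ π K.H) x.cur‖ ^ 2) ≤
      K.Γ₂ + (K.Γ₁ T + K.Γ₃ T) / B := by
  -- `T` descents involve only `N = T - 1` error recursions, which matches the variance bound for `1
  -- ≤ t < T`.
  obtain ⟨N, rfl⟩ : ∃ N, T = N + 1 := ⟨T - 1, by omega⟩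
  have hγ1 : 0 < 1 - K.γ := by linarith [hγ.2]
  have hL := Consts.L_pos hγ hMg hMh
  have hbb := Consts.bSq_pos hγ hMh
  have hm : 2 ≤ K.m := Consts.two_le_m
  have hη := stepSize_pos (m := K.m) hk hm
  have hB1 : (1 : ℝ) ≤ B := by exact_mod_cast hB
  have hcsub : K.c - 96 * K.bSq = 1 / (3 * K.k ^ 3 * K.L) := by
    rw [Consts.c]
    ring
  have hc : 96 * K.bSq ≤ K.c := by
    have : 0 ≤ 1 / (3 * K.k ^ 3 * K.L) := by positivity
    linarith
  have hcη := Consts.c_mul_stepSize_sq_le hL hk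
  have hG : ∀ (θ : Param d) (τ : Traj S A K.H), ‖gpomdp M π b θ τ‖ ≤ K.σ := by
    intro θ τ
    have := norm_gpomdp_le hπ hMg.le hb θ τ
    rwa [hMγ] at this
  have hLg : ∀ (θ θ' : Param d) (τ : Traj S A K.H),
      ‖gpomdp M π b θ τ - gpomdp M π b θ' τ‖ ≤ K.Lg * ‖θ - θ'‖ := by
    intro θ θ' τ
    have := norm_gpomdp_sub_le hπ hMh.le hb θ θ' τ
    rwa [hMγ] at this
  have hsmooth : ∀ θ v : Param d, truncValue M ρ π K.H θ +
      inner ℝ (gradient (truncValue M ρ π K.H) θ) v - K.L / 2 * ‖v‖ ^ 2 ≤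
      truncValue M ρ π K.H (θ + v) := by
    intro θ v
    have := le_truncValue_add (M := M) (H := K.H) hρ hπ hMh.le θ v
    rwa [hMγ] at this
  have key := sum_mul_le_of_descent (N := N) (B := B) (G := K.σ) (c := K.c) (bb := K.bSq)
    (η := stepSize K.k K.m)
    (a := fun n => runMean M ρ π b K.k K.m K.c B θ₁ n (fun x => truncValue M ρ π K.H x.cur))
    (q := fun n => runMean M ρ π b K.k K.m K.c B θ₁ n
      (fun x => ‖gradient (truncValue M ρ π K.H) x.cur‖ ^ 2))
    (U := fun n => runMean M ρ π b K.k K.m K.c B θ₁ n (fun x => ‖x.dir‖ ^ 2))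
    (V := fun n => runMean M ρ π b K.k K.m K.c B θ₁ n
      (fun x => ‖x.dir - gradient (truncValue M ρ π K.H) x.prev‖ ^ 2))
    hη (fun n => stepSize_antitone hk hm n.le_succ) hbb hc hcη
    (fun n => by
      rw [hcsub]
      exact one_div_stepSize_sub_le hk hm hL Consts.two_L_mul_stepSize_le n)
    hB1
    (fun n => runMean_nonneg hρ fun _ => sq_nonneg _)
    (fun n => runMean_nonneg hρ fun _ => sq_nonneg _)
    (fun n => runMean_truncValue_ge hρ (hη _).le
      (by linarith [Consts.two_L_mul_stepSize_le (K := K) (n + 1)]) hsmooth)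
    (runMean_error_one_le hρ hπ hG hB)
    (fun n hn => runMean_error_succ_le hρ hπ hG hLg hB
      (mul_nonneg (by linarith) (sq_nonneg _)) (hcη _) (fun ω hω => by
        rw [Consts.sq_Cw hMh hW]
        exact trajVar_isWeight_le hρ hπ hMh.le hW.le _ _ (hvar (n + 1) (by omega) (by omega) ω hω)))
  refine key.trans ?_
  have ha : ∀ n, runMean M ρ π b K.k K.m K.c B θ₁ n (fun x => truncValue M ρ π K.H x.cur) ∈
      Set.Icc 0 (1 / (1 - K.γ)) := by
    intro n
    have h0 := fun θ : Param d => truncValue_mem (M := M) (π := π) (H := K.H) hρ θ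
    rw [hMγ] at h0
    refine ⟨runMean_nonneg hρ fun x => (h0 _).1, ?_⟩
    exact (runMean_mono hρ fun ω _ => (h0 _).2).trans (runMean_const hρ n _).le
  have h1 := (ha (N + 1)).2
  have h2 := (ha 0).1
  have hlog : ((N : ℝ) + 2) ≤ ((N + 1 : ℕ) : ℝ) + 2 := by
    push_cast
    linarith
  have h3 : ∑ n ∈ Finset.range N, stepSize K.k K.m (n + 1) ^ 3 ≤
      K.k ^ 3 * Real.log ((N + 1 : ℕ) + 2) := by
    refine (sum_stepSize_pow_three_le hk hm N).trans ?_
    gcongr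
  have h4 : stepSize K.k K.m 0 = K.k / K.m ^ (1 / 3 : ℝ) := by simp [stepSize]
  have hm3 : 0 < K.m ^ (1 / 3 : ℝ) := Real.rpow_pos_of_pos (by linarith) _
  have h5 : 1 / (96 * K.bSq) * (K.σ ^ 2 / (B * stepSize K.k K.m 0) +
      2 * K.c ^ 2 * K.σ ^ 2 / B * ∑ n ∈ Finset.range N, stepSize K.k K.m (n + 1) ^ 3) ≤
      (K.Γ₁ (N + 1) + K.Γ₃ (N + 1)) / B := by
    calc _ ≤ 1 / (96 * K.bSq) * (K.σ ^ 2 / (B * stepSize K.k K.m 0) +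
          2 * K.c ^ 2 * K.σ ^ 2 / B * (K.k ^ 3 * Real.log ((N + 1 : ℕ) + 2))) := by gcongr
      -- The first two terms of `Γ₁` already suffice here; its last term and all of `Γ₃` are slack.
      _ = (K.Γ₁ (N + 1) - 1 / (22 * (1 - K.γ))) / B := by
          rw [h4, Consts.Γ₁, add_sub_cancel_right]
          field_simp
          ring
      _ ≤ _ := by
          have h6 := Consts.Γ₃_nonneg hγ hMh hk (N + 1)
          have h7 : 0 ≤ 1 / (22 * (1 - K.γ)) := by positivity
          gcongr
          linarith
  have h8 : 2 * (1 / (1 - K.γ)) ≤ K.Γ₂ := by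
    rw [Consts.Γ₂, ← div_div, ← mul_one_div (48 / 11 : ℝ)]
    gcongr
    norm_num
  linarith

end Main

end StormPG

theorem mainTheorem6 (K : StormPG.Consts)
    (hγ : K.γ ∈ Set.Ioo (0 : ℝ) 1) (hMg : 0 < K.Mg) (hMh : 0 < K.Mh) (hW : 0 < K.W)
    (hk : 0 < K.k) :
    ∃ C : ℝ, ∀ {S A : Type*} [Fintype S] [Fintype A] {d : ℕ}
      (M : StormPG.MDP S A) (ρ : S → ℝ) (π : StormPG.PolicyClass S A d) (b : Fin K.H → ℝ)
      (θ₁ : StormPG.Param d) (B T : ℕ),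
      M.γ = K.γ →
      ρ ∈ stdSimplex ℝ S →
      π.ScoreBounded K.Mg K.Mh →
      (∀ (h : Fin K.H) (s : S) (a : A), |M.γ ^ (h : ℕ) * M.r s a - b h| ≤ M.γ ^ (h : ℕ)) →
      1 ≤ B →
      1 ≤ T →
      StormPG.WeightVarianceBounded M ρ π b K.k K.m K.c B θ₁ T K.W →
      ((1 / (T : ℝ)) * ∑ n ∈ Finset.range T,
            StormPG.meanGradNorm M ρ π b K.k K.m K.c B θ₁ n ≤
          Real.sqrt (K.Γ₂ / K.k + (K.Γ₁ T + K.Γ₃ T) / (K.k * B)) *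
            (K.m ^ (1 / 6 : ℝ) / Real.sqrt T + 1 / (T : ℝ) ^ (1 / 3 : ℝ))) ∧
      ((1 / (T : ℝ)) * ∑ n ∈ Finset.range T,
            StormPG.meanGradNorm M ρ π b K.k K.m K.c B θ₁ n ≤
          C * Real.sqrt (Real.log (T + 2)) * (T : ℝ) ^ (-(1 / 3) : ℝ)) := by
  -- This constant results from dropping `B ≥ 1`, multiplying the terms free of `T` by `log (T + 2)
  -- ≥ 1`, and replacing `T^{-1/2}` by `T^{-1/3}`.
  refine ⟨Real.sqrt ((K.Γ₂ + K.logCoeff) / K.k) * (K.m ^ (1 / 6 : ℝ) + 1), ?_⟩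
  intro S A _ _ d M ρ π b θ₁ B T hMγ hρ hπ hb hB hT hvar
  have hB1 : (1 : ℝ) ≤ B := by exact_mod_cast hB
  have hB0 : (0 : ℝ) < B := by linarith
  have hT1 : (1 : ℝ) ≤ T := by exact_mod_cast hT
  have hT0 : (0 : ℝ) < T := by linarith
  have hm : 2 ≤ K.m := StormPG.Consts.two_le_m
  have hΓ : 0 ≤ K.Γ₁ T + K.Γ₃ T := add_nonneg (StormPG.Consts.Γ₁_nonneg hγ hMh hk T)
    (StormPG.Consts.Γ₃_nonneg hγ hMh hk T)
  have hΓ₂ := StormPG.Consts.Γ₂_pos hγ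
  have h1 : (1 / (T : ℝ)) * ∑ n ∈ Finset.range T,
      StormPG.meanGradNorm M ρ π b K.k K.m K.c B θ₁ n ≤
      Real.sqrt (K.Γ₂ / K.k + (K.Γ₁ T + K.Γ₃ T) / (K.k * B)) *
        (K.m ^ (1 / 6 : ℝ) / Real.sqrt T + 1 / (T : ℝ) ^ (1 / 3 : ℝ)) := by
    have e1 : K.Γ₂ / K.k + (K.Γ₁ T + K.Γ₃ T) / (K.k * B) =
        (K.Γ₂ + (K.Γ₁ T + K.Γ₃ T) / B) / K.k := by
      field_simp
    simp_rw [e1, StormPG.meanGradNorm_eq]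
    exact StormPG.average_le_of_sum_stepSize_mul_le hk hm hT
      (add_nonneg hΓ₂.le (div_nonneg hΓ hB0.le))
      (fun n => StormPG.sq_runMean_le hρ n _)
      (StormPG.sum_stepSize_mul_mean_sq_le hγ hMg hMh hW hk hMγ hρ hπ hb hB hT hvar)
  refine ⟨h1, h1.trans ?_⟩
  have hlog := StormPG.Consts.one_le_log hT
  have hle := StormPG.Consts.Γ₁_add_Γ₃_le hγ hMh hk hT
  have h2 : K.Γ₂ / K.k + (K.Γ₁ T + K.Γ₃ T) / (K.k * B) ≤
      (K.Γ₂ + K.logCoeff) / K.k * Real.log (T + 2) := by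
    calc _ ≤ K.Γ₂ / K.k + (K.Γ₁ T + K.Γ₃ T) / K.k := by
          gcongr
          exact le_mul_of_one_le_right hk.le hB1
      _ ≤ K.Γ₂ * Real.log (T + 2) / K.k + K.logCoeff * Real.log (T + 2) / K.k := by
          gcongr
          exact le_mul_of_one_le_right hΓ₂.le hlog
      _ = _ := by ring
  have h3 : 1 / Real.sqrt T ≤ (T : ℝ) ^ (-(1 / 3) : ℝ) := by
    rw [Real.sqrt_eq_rpow, one_div, ← Real.rpow_neg hT0.le]
    exact Real.rpow_le_rpow_of_exponent_le hT1 (by norm_num)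
  have h4 : K.m ^ (1 / 6 : ℝ) / Real.sqrt T + 1 / (T : ℝ) ^ (1 / 3 : ℝ) ≤
      (K.m ^ (1 / 6 : ℝ) + 1) * (T : ℝ) ^ (-(1 / 3) : ℝ) := by
    have h5 := mul_le_mul_of_nonneg_left h3 (Real.rpow_nonneg (by linarith : 0 ≤ K.m) (1 / 6))
    rw [one_div ((T : ℝ) ^ (1 / 3 : ℝ)), ← Real.rpow_neg hT0.le]
    rw [mul_one_div] at h5
    linarith
  have hm6 : 0 ≤ K.m ^ (1 / 6 : ℝ) := Real.rpow_nonneg (by linarith) _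
  calc _ ≤ Real.sqrt ((K.Γ₂ + K.logCoeff) / K.k * Real.log (T + 2)) *
        ((K.m ^ (1 / 6 : ℝ) + 1) * (T : ℝ) ^ (-(1 / 3) : ℝ)) := by gcongr
    _ = _ := by
      rw [Real.sqrt_mul' _ (by linarith)]
      ring
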